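/- Let $q\ge 2$ and $K\le L\le M$ be integers with $K\ge 2829$. Let $\Lambda$ be the three-dimensional box $\{1,\dots,K\}\times\{1,\dots,L\}\times\{1,\dots,M\}$ with open or periodic boundary conditions (in the periodic case $\Lambda$ is the discrete torus $(\mathbb Z/K\mathbb Z)\times(\mathbb Z/L\mathbb Z)\times(\mathbb Z/M\mathbb Z)$), and write $x\sim y$ for sites at Euclidean distance $1$. For a spin configuration $\sigma\in\mathcal X=\{1,\dots,q\}^{\Lambda}$ let $$H(\sigma)=\sum_{\{x,y\}\subseteq\Lambda:\ x\sim y}\mathbf 1\{\sigma(x)\neq\sigma(y)\}$$ be the Ising/Potts Hamiltonian without external field. Its ground states are the monochromatic configurations $\mathbf s_1,\dots,\mathbf s_q$, where $\mathbf s_a(x)=a$ for all $x\in\Lambda$. A path is a finite sequence $\omega_0,\dots,\omega_T$ ($T\ge 0$) in $\mathcal X$ in which consecutive configurations differ at exactly one site; it connects $\sigma$ and $\zeta$ if $\{\omega_0,\omega_T\}=\{\sigma,\zeta\}$. The communication height is $$\Phi(\sigma,\zeta)=\min_{(\omega_t)_{t=0}^T}\ \max_{0\le t\le T}H(\omega_t),$$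 the minimum being over all paths connecting $\sigma$ and $\zeta$. Then for any two distinct ground states $\mathbf s,\mathbf s'$ the energy barrier $\Gamma=\Phi(\mathbf s,\mathbf s')$ is $$\Gamma=\begin{cases}2KL+2K+2&\text{under periodic boundary conditions},\\ KL+K+1&\text{under open boundary conditions}.\end{cases}$$ -/

import Mathlib

namespace Potts3D

/-- The two kinds of boundary conditions imposed on the lattice box. -/
inductive BoundaryCondition where
  | openBC
  | periodicBC

/-- The sites of the `K × L × M` box; the coordinates run through `0, …, n - 1`
(instead of `1, …, n`), and under periodic boundary conditions they are read modulo `n`. -/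
abbrev Site (K L M : ℕ) : Type := Fin K × Fin L × Fin M

/-- Distance of two coordinates: `|i - j|` under open boundary conditions, and the distance in the
discrete torus `ℤ / nℤ` (the least absolute value in the class of `i - j`) under periodic ones. -/
def coordDist (bc : BoundaryCondition) (n : ℕ) (i j : Fin n) : ℕ :=
  match bc with
  | .openBC => ((i.val : ℤ) - (j.val : ℤ)).natAbs
  | .periodicBC => (((i.val : ZMod n) - (j.val : ZMod n)).valMinAbs).natAbs

theorem coordDist_comm (bc : BoundaryCondition) (n : ℕ) (i j : Fin n) :
    coordDist bc n i j = coordDist bc n j i := by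
  cases bc with
  | openBC => simp only [coordDist]; omega
  | periodicBC =>
    simp only [coordDist]
    rw [← neg_sub, ZMod.natAbs_valMinAbs_neg]

theorem coordDist_self (bc : BoundaryCondition) (n : ℕ) (i : Fin n) :
    coordDist bc n i i = 0 := by
  cases bc <;> simp [coordDist]

/-- The square of the Euclidean distance of two sites. -/
def sqDist (bc : BoundaryCondition) {K L M : ℕ} (x y : Site K L M) : ℕ :=
  coordDist bc K x.1 y.1 ^ 2 + coordDist bc L x.2.1 y.2.1 ^ 2 + coordDist bc M x.2.2 y.2.2 ^ 2

/-- The nearest-neighbour graph of the box: `x ∼ y` iff their Euclidean distance is `1`. -/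
def lattice (bc : BoundaryCondition) (K L M : ℕ) : SimpleGraph (Site K L M) where
  Adj x y := sqDist bc x y = 1
  symm := ⟨fun x y h => by
    simp only [sqDist] at h ⊢
    rw [coordDist_comm bc K y.1, coordDist_comm bc L y.2.1, coordDist_comm bc M y.2.2]
    exact h⟩
  loopless := ⟨fun x h => by simp [sqDist, coordDist_self] at h⟩

instance (bc : BoundaryCondition) (K L M : ℕ) : DecidableRel (lattice bc K L M).Adj :=
  fun x y => inferInstanceAs (Decidable (sqDist bc x y = 1))

/-- Spin configurations on the box with the `q` spins `0, …, q - 1`. -/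
abbrev Config (q K L M : ℕ) : Type := Site K L M → Fin q

/-- `1` if the spins at the two ends of the pair `e` differ, and `0` otherwise. -/
def disagree {q K L M : ℕ} (σ : Config q K L M) (e : Sym2 (Site K L M)) : ℝ :=
  Sym2.lift ⟨fun x y => if σ x ≠ σ y then (1 : ℝ) else 0,
    fun x y => by simp only [ne_comm]⟩ e

/-- The Ising/Potts Hamiltonian without external field, a sum over the unordered pairs of
neighbouring sites. -/
def hamiltonian (bc : BoundaryCondition) {q K L M : ℕ} (σ : Config q K L M) : ℝ :=
  ∑ e ∈ (lattice bc K L M).edgeFinset, disagree σ e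

/-- The monochromatic configuration with all spins equal to `a`. -/
def mono (q K L M : ℕ) (a : Fin q) : Config q K L M := fun _ => a

/-- The set of ground states, i.e. of the monochromatic configurations. -/
def groundStates (q K L M : ℕ) : Set (Config q K L M) := Set.range (mono q K L M)

/-- `σ ∼ ζ`: the configuration `ζ ≠ σ` arises from `σ` by updating one spin, i.e. the
Metropolis–Hastings dynamics jumps from `σ` to `ζ` with positive rate. -/
def Neighbor {q K L M : ℕ} (σ ζ : Config q K L M) : Prop :=
  ζ ≠ σ ∧ ∃ (x : Site K L M) (a : Fin q), ζ = Function.update σ x a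

/-- `ω 0, …, ω T` is a path. -/
def IsPath {q K L M T : ℕ} (ω : Fin (T + 1) → Config q K L M) : Prop :=
  ∀ t : Fin T, Neighbor (ω t.castSucc) (ω t.succ)

/-- `ω` goes from `σ` to `ζ` or vice versa. -/
def Connects {q K L M T : ℕ} (ω : Fin (T + 1) → Config q K L M) (σ ζ : Config q K L M) : Prop :=
  (ω 0 = σ ∧ ω (Fin.last T) = ζ) ∨ (ω 0 = ζ ∧ ω (Fin.last T) = σ)

/-- The maximal energy along `ω`. -/
noncomputable def pathHeight (bc : BoundaryCondition) {q K L M T : ℕ}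
    (ω : Fin (T + 1) → Config q K L M) : ℝ :=
  Finset.univ.sup' Finset.univ_nonempty fun t => hamiltonian bc (ω t)

/-- The heights of all paths (of any length) that connect `σ` and `ζ`. -/
def pathHeights (bc : BoundaryCondition) {q K L M : ℕ} (σ ζ : Config q K L M) : Set ℝ :=
  {h | ∃ (T : ℕ) (ω : Fin (T + 1) → Config q K L M),
    IsPath ω ∧ Connects ω σ ζ ∧ h = pathHeight bc ω}

/-- The communication height `Φ(σ, ζ)`: the minimum of the heights of the paths that connect
`σ` and `ζ`. -/
noncomputable def commHeight (bc : BoundaryCondition) {q K L M : ℕ} (σ ζ : Config q K L M) : ℝ :=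
  sInf (pathHeights bc σ ζ)

end Potts3D

namespace Potts3D

/-! A line parallel to an axis on which the spin is not constant breaks at least one bond, and at
least two on the torus; this factor `bondsPerLine` is the only trace of the boundary condition. The
upper bound comes from filling the box in lexicographic order: at any time at most one row, `K`
lines within one layer and `K L` vertical lines are non-constant, and each breaks as few bonds as
possible (`hamiltonian_fillConfig_le`).

For the lower bound, mark the cells that carry the initial spin. Their number drops by at most one
per step, so every path passes the critical volume `K L (M / 2) + K (L / 2 + 2) + 1`. It remains to
see that a two-coloured box of this volume has more than `K L + K` mixed, i.e. non-constant, lines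
(`mixed_lines_lower_bound`).

Suppose it has fewer, and cut it into horizontal slices. A slice with fewer than `K` mixed lines,
say `n`, has one colour confined to at most `n ^ 2 / 4` cells (`planar_alternative`), and the number
`V` of mixed vertical lines bounds the difference of any two slice areas. If such minorities of both
colours occur, then `V` uses up nearly all of `K L`, and the few lines left over make the volume
almost that of a stack of full slices, or a multiple of `K` (`slab_volume`); the critical volume is
neither. Otherwise a concavity argument shows that every slice has at least `K` mixed lines
(`all_slices_mixed`). Then `M ≤ L + 1` and some slice is a strip. By `strip_rigidity` all slices are
mixed on nearly all lines along the strip, so few mixed lines remain for the other directions, and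
`slab_volume`, applied to slices cut the other way, again contradicts the choice of the volume. -/

/-- The two-valued function `g` is not constant. -/
def Mixed {ι : Type*} (g : ι → Bool) : Prop := ∃ i j, g i ≠ g j

open Classical in
/-- The indicator of `Mixed g`. -/
noncomputable def mixedInd {ι : Type*} (g : ι → Bool) : ℕ := if Mixed g then 1 else 0

theorem mixedInd_le_one {ι : Type*} (g : ι → Bool) : mixedInd g ≤ 1 := by
  unfold mixedInd; split_ifs <;> omega

theorem mixedInd_eq_one {ι : Type*} {g : ι → Bool} (h : Mixed g) : mixedInd g = 1 := by
  simp [mixedInd, h]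

theorem mixedInd_eq_zero {ι : Type*} {g : ι → Bool} : mixedInd g = 0 ↔ ¬ Mixed g := by
  simp [mixedInd]

theorem eq_of_not_mixed {ι : Type*} {g : ι → Bool} (h : ¬ Mixed g) (i j : ι) : g i = g j := by
  by_contra hne
  exact h ⟨i, j, hne⟩

theorem mixed_not {ι : Type*} {g : ι → Bool} : Mixed (fun i => !g i) ↔ Mixed g := by
  simp [Mixed]

theorem mixedInd_not {ι : Type*} (g : ι → Bool) : mixedInd (fun i => !g i) = mixedInd g := by
  by_cases h : Mixed g
  · rw [mixedInd_eq_one h, mixedInd_eq_one (mixed_not.2 h)]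
  · rw [mixedInd_eq_zero.2 h, mixedInd_eq_zero.2 (mixed_not.not.2 h)]

theorem toNat_le_add_mixedInd {ι : Type*} (g : ι → Bool) (i j : ι) :
    (g i).toNat ≤ (g j).toNat + mixedInd g := by
  by_cases h : Mixed g
  · have := mixedInd_eq_one h
    have := Bool.toNat_le (g i)
    omega
  · rw [eq_of_not_mixed h i j]; omega

/-! ### Planar regions: area against the number of mixed lines -/

section Planar

variable {α β : Type*}

/-- The number of cells of a planar region. -/
def area [Fintype α] [Fintype β] (S : α → β → Bool) : ℕ := ∑ x, ∑ y, (S x y).toNat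

/-- The number of lines `S x` on which `S` is not constant. -/
noncomputable def mixedRows [Fintype α] (S : α → β → Bool) : ℕ := ∑ x, mixedInd (S x)

/-- The number of lines `S · y` on which `S` is not constant. -/
noncomputable def mixedCols [Fintype β] (S : α → β → Bool) : ℕ := ∑ y, mixedInd fun x => S x y

theorem mixedRows_le [Fintype α] (S : α → β → Bool) : mixedRows S ≤ Fintype.card α := by
  calc mixedRows S ≤ ∑ _x : α, 1 := Finset.sum_le_sum fun x _ => mixedInd_le_one _
    _ = _ := by simp

theorem area_flip [Fintype α] [Fintype β] (S : α → β → Bool) : area (fun y x => S x y) = area S :=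
  Finset.sum_comm

theorem mixedCols_le [Fintype β] (S : α → β → Bool) : mixedCols S ≤ Fintype.card β :=
  mixedRows_le fun y x => S x y

theorem mixedRows_not [Fintype α] (S : α → β → Bool) : mixedRows (fun x y => !S x y) =
    mixedRows S :=
  Finset.sum_congr rfl fun x _ => mixedInd_not (S x)

theorem mixedCols_not [Fintype β] (S : α → β → Bool) : mixedCols (fun x y => !S x y) =
    mixedCols S :=
  Finset.sum_congr rfl fun y _ => mixedInd_not fun x => S x y

theorem area_add_area_not [Fintype α] [Fintype β] (S : α → β → Bool) :
    area S + area (fun x y => !S x y) = Fintype.card α * Fintype.card β := by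
  unfold area
  rw [← Finset.sum_add_distrib]
  have h : ∀ x, ∑ y, (S x y).toNat + ∑ y, (!S x y).toNat = Fintype.card β := by
    intro x
    rw [← Finset.sum_add_distrib, ← Finset.card_univ, Finset.card_eq_sum_ones]
    refine Finset.sum_congr rfl fun y _ => ?_
    cases S x y <;> rfl
  simp [h]

theorem exists_not_mixed_of_sum_lt {ι κ : Type*} [Fintype ι] {g : ι → κ → Bool}
    (h : ∑ i, mixedInd (g i) < Fintype.card ι) : ∃ i, ¬ Mixed (g i) := by
  by_contra! hc
  have : ∑ i, mixedInd (g i) = Fintype.card ι := by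
    simp [mixedInd_eq_one (hc _)]
  omega

/-- The constant row and the constant column cross, so both are entirely `false`. Every row and
every column meets one of them, hence a `true` cell makes its own row and column mixed. -/
theorem area_le_mul_of_const [Fintype α] [Fintype β] {S : α → β → Bool} {x₀ : α} {y₀ : β}
    (hx : ¬ Mixed (S x₀))
    (hy : ¬ Mixed fun x => S x y₀) (h : S x₀ y₀ = false) :
    area S ≤ mixedRows S * mixedCols S := by
  unfold area mixedRows mixedCols
  rw [Finset.sum_mul_sum]
  refine Finset.sum_le_sum fun x _ => Finset.sum_le_sum fun y _ => ?_
  cases hS : S x y with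
  | false => simp
  | true =>
    have h1 : Mixed (S x) := ⟨y, y₀, by
      have : S x y₀ = S x₀ y₀ := eq_of_not_mixed hy x x₀
      simp [hS, this, h]⟩
    have h2 : Mixed fun x => S x y := ⟨x, x₀, by
      have : S x₀ y = S x₀ y₀ := eq_of_not_mixed hx y y₀
      simp [hS, this, h]⟩
    simp [mixedInd_eq_one h1, mixedInd_eq_one h2]

/-- If there are constant lines in both directions, one of the two colours is confined to the
product of the non-constant lines. -/
theorem area_le_mul_or [Fintype α] [Fintype β] (S : α → β → Bool)
    (hr : mixedRows S < Fintype.card α)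
    (hc : mixedCols S < Fintype.card β) :
    area S ≤ mixedRows S * mixedCols S ∨
      Fintype.card α * Fintype.card β ≤ area S + mixedRows S * mixedCols S := by
  obtain ⟨x₀, hx⟩ := exists_not_mixed_of_sum_lt hr
  obtain ⟨y₀, hy⟩ := exists_not_mixed_of_sum_lt hc
  cases h : S x₀ y₀ with
  | false => exact Or.inl (area_le_mul_of_const hx hy h)
  | true =>
    right
    have := area_le_mul_of_const (S := fun x y => !S x y) (x₀ := x₀) (y₀ := y₀)
      (by rwa [mixed_not]) (mixed_not.not.2 hy) (by simp [h])
    rw [mixedRows_not, mixedCols_not] at this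
    have := area_add_area_not S
    omega

theorem dvd_area_of_mixedRows_eq_zero [Fintype α] [Fintype β] {S : α → β → Bool}
    (h : mixedRows S = 0) :
    Fintype.card β ∣ area S := by
  refine Finset.dvd_sum fun x _ => ?_
  have hx : ¬ Mixed (S x) := mixedInd_eq_zero.1 (Finset.sum_eq_zero_iff.1 h x (Finset.mem_univ x))
  by_cases hex : ∃ y, S x y = true
  · obtain ⟨y, hy⟩ := hex
    have : ∀ y', S x y' = true := fun y' => (eq_of_not_mixed hx y' y).trans hy
    simp [this]
  · push Not at hex
    simp [hex]

theorem dvd_area_of_mixedCols_eq_zero [Fintype α] [Fintype β] {S : α → β → Bool}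
    (h : mixedCols S = 0) :
    Fintype.card α ∣ area S := by
  rw [← area_flip]
  exact dvd_area_of_mixedRows_eq_zero h

/-- The planar isoperimetric alternative. -/
theorem planar_alternative [Fintype α] [Fintype β] (S : α → β → Bool)
    (hab : Fintype.card α ≤ Fintype.card β) :
    Fintype.card α < mixedRows S + mixedCols S ∨
    (mixedRows S + mixedCols S = Fintype.card α ∧ Fintype.card α ∣ area S) ∨
    4 * area S ≤ (mixedRows S + mixedCols S) ^ 2 ∨
    4 * (Fintype.card α * Fintype.card β) ≤ 4 * area S + (mixedRows S + mixedCols S) ^ 2 := by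
  have h1 := mixedRows_le S
  have h2 := mixedCols_le S
  have hsq : 4 * (mixedRows S * mixedCols S) ≤ (mixedRows S + mixedCols S) ^ 2 := by
    have := four_mul_le_sq_add (mixedRows S : ℕ) (mixedCols S)
    linarith
  by_cases hr : mixedRows S < Fintype.card α
  · by_cases hc : mixedCols S < Fintype.card β
    · rcases area_le_mul_or S hr hc with h | h
      · right; right; left; omega
      · right; right; right; omega
    -- All columns are mixed here, so the total is at least `card β`. It can equal `card α` only for
    -- a square without mixed rows, where the area is a multiple of the side.
    · by_cases h0 : mixedRows S = 0
      · by_cases hlt : Fintype.card α < Fintype.card β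
        · left; omega
        · right; left
          have := dvd_area_of_mixedRows_eq_zero h0
          have he : Fintype.card α = Fintype.card β := by omega
          exact ⟨by omega, he ▸ this⟩
      · left; omega
  · by_cases h0 : mixedCols S = 0
    · right; left
      exact ⟨by omega, dvd_area_of_mixedCols_eq_zero h0⟩
    · left; omega

end Planar

/-! ### Arithmetic of a stack of slices with areas `t` and mixed-line counts `n` -/

/-- The concave function `m ↦ m (4 w - m)` is least at an end of `[0, P]`, and `4 w ≤ P` makes that
end `P`. -/
theorem mul_four_sub_ge {m w P : ℤ} (hm : 0 ≤ m) (hmP : m ≤ P) (h : 4 * w ≤ P) :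
    P * (4 * w - P) ≤ m * (4 * w - m) := by
  nlinarith [mul_nonneg (sub_nonneg.2 hmP) hm, mul_nonneg (sub_nonneg.2 hmP) (sub_nonneg.2 h),
    mul_nonneg (sub_nonneg.2 hmP) (sub_nonneg.2 hmP)]

/-- In a stack of low energy with `w` and `b` slices of either strong majority, both numbers exceed
`P / 4`. Here `m` and `m'` are the least numbers of mixed lines in such slices. -/
theorem balanced_of_energy {P E R m m' w b X : ℤ} (hP : 1000 ≤ P) (hEP : E ≤ P) (hR : P ≤ R + 1)
    (hm : 0 ≤ m) (hmP : m < P) (hm' : 0 ≤ m') (hmP' : m' < P)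
    (hsum : w + b + X = R)
    (hE : m * (4 * w - m) + m' * (4 * b - m') + 4 * P * X ≤ 4 * E)
    (hwle : 8 * w ≤ 4 * R + P + 24) (hble : 8 * b ≤ 4 * R + P + 24) :
    P < 4 * w ∧ P < 4 * b := by
  by_cases h1 : P < 4 * w
  · refine ⟨h1, ?_⟩
    -- If `b ≤ P / 4`, the energy bound leaves `b + X ≤ P / 4 + 1`. Then `w` is nearly `R - P / 4`,
    -- which exceeds the volume bound `R / 2 + P / 8 + 3` because `R ≥ P - 1`.
    by_contra! h2
    have e1 := mul_four_sub_ge hm' hmP'.le h2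
    have e2 : 0 ≤ m * (4 * w - m) := mul_nonneg hm (by linarith)
    have : P * (4 * b - P + 4 * X - 4) ≤ 0 := by nlinarith
    have : 4 * b - P + 4 * X - 4 ≤ 0 := by
      by_contra! h; nlinarith [mul_pos (show (0:ℤ) < P by linarith) h]
    omega
  · exfalso
    push Not at h1
    have e1 := mul_four_sub_ge hm hmP.le h1
    by_cases h2 : P < 4 * b
    · have e2 : 0 ≤ m' * (4 * b - m') := mul_nonneg hm' (by linarith)
      have : P * (4 * w - P + 4 * X - 4) ≤ 0 := by nlinarith
      have : 4 * w - P + 4 * X - 4 ≤ 0 := by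
        by_contra! h; nlinarith [mul_pos (show (0:ℤ) < P by linarith) h]
      omega
    -- With both numbers at most `P / 4` the energy bound gives `4 R ≤ 2 P + 4`, against `P ≤ R +
    -- 1`.
    · push Not at h2
      have e2 := mul_four_sub_ge hm' hmP'.le h2
      have : P * (4 * w - P + (4 * b - P) + 4 * X - 4) ≤ 0 := by nlinarith
      have : 4 * w - P + (4 * b - P) + 4 * X - 4 ≤ 0 := by
        by_contra! h; nlinarith [mul_pos (show (0:ℤ) < P by linarith) h]
      omega

theorem sum_sq_le_sq_sum {ι : Type*} (s : Finset ι) (n : ι → ℤ) (h : ∀ z ∈ s, 0 ≤ n z) :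
    ∑ z ∈ s, n z ^ 2 ≤ (∑ z ∈ s, n z) ^ 2 := by
  rw [sq, Finset.sum_mul]
  refine Finset.sum_le_sum fun z hz => ?_
  rw [sq]
  exact mul_le_mul_of_nonneg_left (Finset.single_le_sum h hz) (h z hz)

/-- Volume bound: a colour that is a minority in the slices of `s` cannot fill the stack. -/
theorem card_minority_le {ι : Type*} [Fintype ι] [DecidableEq ι] {n t : ι → ℤ} {P Q S R : ℤ}
    (s : Finset ι) (hP : 0 < P) (hPQ : P ≤ Q)
    (hn : ∀ z, 0 ≤ n z) (htle : ∀ z, t z ≤ P * Q)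
    (hs : ∀ z ∈ s, n z < P ∧ 4 * t z ≤ n z ^ 2)
    (hR : (Fintype.card ι : ℤ) = R) (hS : ∑ z, n z ≤ S) (hSle : 2 * S ≤ P * Q + 2 * P)
    (hvol : R * (P * Q) - 2 * (P * Q) ≤ 2 * ∑ z, t z) :
    8 * (s.card : ℤ) ≤ 4 * R + P + 24 := by
  have h1 : ∑ z, t z = ∑ z ∈ s, t z + ∑ z ∈ sᶜ, t z := (Finset.sum_add_sum_compl s t).symm
  have h2 : ∑ z ∈ sᶜ, t z ≤ (R - s.card) * (P * Q) := by
    have : ∑ z ∈ sᶜ, t z ≤ ∑ _z ∈ sᶜ, P * Q := Finset.sum_le_sum fun z _ => htle z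
    have hc : ((sᶜ).card : ℤ) = R - s.card := by
      rw [Finset.card_compl, Nat.cast_sub (Finset.card_le_univ s), hR]
    rwa [Finset.sum_const, nsmul_eq_mul, hc] at this
  -- From `4 t ≤ n ^ 2 ≤ P n`: all minority slices together hold about as much as `P / 8` full
  -- slices. This is the source of the term `P` in the conclusion.
  have h3 : 4 * ∑ z ∈ s, t z ≤ P * S := by
    calc 4 * ∑ z ∈ s, t z = ∑ z ∈ s, 4 * t z := by rw [Finset.mul_sum]
      _ ≤ ∑ z ∈ s, P * n z := Finset.sum_le_sum fun z hz => by
        have := hs z hz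
        nlinarith [hn z]
      _ = P * ∑ z ∈ s, n z := by rw [Finset.mul_sum]
      _ ≤ P * S := by
        refine mul_le_mul_of_nonneg_left (le_trans ?_ hS) hP.le
        exact Finset.sum_le_sum_of_subset_of_nonneg (Finset.subset_univ s) fun z _ _ => hn z
  have hPQ0 : 0 < P * Q := mul_pos hP (by linarith)
  have h4 : P * (2 * S) ≤ P * (P * Q + 2 * P) := mul_le_mul_of_nonneg_left hSle hP.le
  have h5 : P * P ≤ P * Q := mul_le_mul_of_nonneg_left hPQ hP.le
  have h6 : (P * Q) * (8 * s.card - 4 * R - P - 24) ≤ 0 := by nlinarith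
  by_contra! h
  nlinarith [mul_pos hPQ0 (show (0:ℤ) < 8 * s.card - 4 * R - P - 24 by linarith)]

/-- The slices of a stack whose energy is at most `P Q + E`, if both colours occur as a strong
majority: the volume is that of a slab up to a small error, or a multiple of `P`. -/
theorem slab_volume {ι : Type*} [Fintype ι] {n t : ι → ℤ} {P Q E R V : ℤ}
    (hP : 1000 ≤ P) (hPQ : P ≤ Q) (hR : (Fintype.card ι : ℤ) = R) (hPR : P ≤ R + 1) (hEP : E ≤ P)
    (hn : ∀ z, 0 ≤ n z) (ht : ∀ z, 0 ≤ t z) (htle : ∀ z, t z ≤ P * Q)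
    (halt : ∀ z, P < n z ∨ (n z = P ∧ P ∣ t z) ∨ 4 * t z ≤ n z ^ 2 ∨
      4 * (P * Q) ≤ 4 * t z + n z ^ 2)
    (hV : ∀ z z', t z' ≤ t z + V) (hN : V + ∑ z, n z ≤ P * Q + E)
    (hvol₁ : R * (P * Q) - 2 * (P * Q) ≤ 2 * ∑ z, t z)
    (hvol₂ : 2 * ∑ z, t z ≤ R * (P * Q) + 2 * (P * Q))
    (hW : ∃ z, n z < P ∧ 4 * t z ≤ n z ^ 2)
    (hB : ∃ z, n z < P ∧ 4 * (P * Q) ≤ 4 * t z + n z ^ 2) :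
    (0 ≤ E ∧ ∃ v d : ℤ, ∑ z, t z = P * Q * v + d ∧ 4 * |d| ≤ (E + 16) ^ 2) ∨
      (P ≤ E ∧ P ∣ ∑ z, t z) := by
  classical
  -- `W` and `B` are the nearly empty and the nearly full slices; `X` collects the expensive ones.
  set W : Finset ι := {z | n z < P ∧ 4 * t z ≤ n z ^ 2} with hWdef
  set B : Finset ι := {z | n z < P ∧ 4 * (P * Q) ≤ 4 * t z + n z ^ 2} with hBdef
  set X : Finset ι := {z | P ≤ n z} with hXdef
  have hP0 : 0 < P := by linarith
  have hPP : P * P ≤ P * Q := mul_le_mul_of_nonneg_left hPQ hP0.le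
  have hlt : ∀ z, n z < P → n z ^ 2 < P * P := fun z hz => by nlinarith [hn z]
  have hWB : Disjoint W B := by
    rw [Finset.disjoint_left]
    intro z h1 h2
    simp only [hWdef, hBdef, Finset.mem_filter, Finset.mem_univ, true_and] at h1 h2
    have := hlt z h1.1
    nlinarith
  have hWBX : Disjoint (W ∪ B) X := by
    rw [Finset.disjoint_left]
    intro z h1 h2
    simp only [hWdef, hBdef, hXdef, Finset.mem_union, Finset.mem_filter, Finset.mem_univ,
      true_and] at h1 h2
    rcases h1 with h1 | h1 <;> linarith [h1.1]
  have huniv : (W ∪ B) ∪ X = Finset.univ := by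
    ext z
    simp only [hWdef, hBdef, hXdef, Finset.mem_union, Finset.mem_filter, Finset.mem_univ,
      true_and, iff_true]
    rcases halt z with h | h | h | h
    · right; linarith
    · right; linarith [h.1]
    · by_cases hz : n z < P
      · left; left; exact ⟨hz, h⟩
      · right; linarith
    · by_cases hz : n z < P
      · left; right; exact ⟨hz, h⟩
      · right; linarith
  have hsplit : ∀ f : ι → ℤ, ∑ z, f z = ∑ z ∈ W, f z + ∑ z ∈ B, f z + ∑ z ∈ X, f z := fun f => by
    rw [← huniv, Finset.sum_union hWBX, Finset.sum_union hWB]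
  have hcard : (W.card : ℤ) + B.card + X.card = R := by
    have := hsplit fun _ => 1
    simp only [Finset.sum_const, nsmul_eq_mul, mul_one, Finset.card_univ] at this
    linarith
  obtain ⟨zw, hzw, hzwmin⟩ := Finset.exists_min_image W n
    (by obtain ⟨z, hz⟩ := hW; exact ⟨z, by simpa [hWdef] using hz⟩)
  obtain ⟨zb, hzb, hzbmin⟩ := Finset.exists_min_image B n
    (by obtain ⟨z, hz⟩ := hB; exact ⟨z, by simpa [hBdef] using hz⟩)
  have hWmem : ∀ z ∈ W, n z < P ∧ 4 * t z ≤ n z ^ 2 := fun z hz => by simpa [hWdef] using hz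
  have hBmem : ∀ z ∈ B, n z < P ∧ 4 * (P * Q) ≤ 4 * t z + n z ^ 2 := fun z hz => by
    simpa [hBdef] using hz
  have hXmem : ∀ z ∈ X, P ≤ n z := fun z hz => by simpa [hXdef] using hz
  clear_value W B X
  set m := n zw
  set m' := n zb
  have hm0 : 0 ≤ m := hn zw
  have hm0' : 0 ≤ m' := hn zb
  have hmP := (hWmem zw hzw).1
  have hmP' := (hBmem zb hzb).1
  -- Comparing the cheapest slice of `W` with the cheapest of `B` shows that the vertical mixed
  -- lines alone use almost all of `P Q`.
  have hVge : 4 * (P * Q) - m ^ 2 - m' ^ 2 ≤ 4 * V := by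
    have := hV zw zb
    have := (hWmem zw hzw).2
    have := (hBmem zb hzb).2
    linarith
  have hm2 := hlt zw hmP
  have hm2' := hlt zb hmP'
  have hSle : 2 * ∑ z, n z ≤ P * Q + 2 * P := by linarith
  have hwle : 8 * (W.card : ℤ) ≤ 4 * R + P + 24 :=
    card_minority_le W hP0 hPQ hn htle hWmem hR le_rfl hSle hvol₁
  have hble : 8 * (B.card : ℤ) ≤ 4 * R + P + 24 := by
    refine card_minority_le (t := fun z => P * Q - t z) B hP0 hPQ hn
      (fun z => by linarith [ht z]) (fun z hz => ?_) hR le_rfl hSle ?_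
    · have := hBmem z hz
      exact ⟨this.1, by linarith⟩
    · rw [Finset.sum_sub_distrib, Finset.sum_const, nsmul_eq_mul, Finset.card_univ, hR]
      linarith
  have hSW : W.card * m ≤ ∑ z ∈ W, n z := by
    have := Finset.card_nsmul_le_sum W n m hzwmin
    rwa [nsmul_eq_mul] at this
  have hSB : B.card * m' ≤ ∑ z ∈ B, n z := by
    have := Finset.card_nsmul_le_sum B n m' hzbmin
    rwa [nsmul_eq_mul] at this
  have hSX : X.card * P ≤ ∑ z ∈ X, n z := by
    have := Finset.card_nsmul_le_sum X n P hXmem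
    rwa [nsmul_eq_mul] at this
  have hNs := hsplit n
  obtain ⟨hw4, hb4⟩ := balanced_of_energy (E := E) (R := R) (m := m) (m' := m') (w := W.card)
    (b := B.card) (X := X.card) hP hEP hPR hm0 hmP hm0' hmP'
    hcard (by linarith) hwle hble
  have hmw : 0 ≤ m * (4 * W.card - P) := mul_nonneg hm0 (by linarith)
  have hmb : 0 ≤ m' * (4 * B.card - P) := mul_nonneg hm0' (by linarith)
  have hmm : 0 ≤ m * (P - m) := mul_nonneg hm0 (by linarith)
  have hmm' : 0 ≤ m' * (P - m') := mul_nonneg hm0' (by linarith)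
  have hSW0 : 0 ≤ ∑ z ∈ W, n z := Finset.sum_nonneg fun z _ => hn z
  have hSB0 : 0 ≤ ∑ z ∈ B, n z := Finset.sum_nonneg fun z _ => hn z
  have hdW : 0 ≤ ∑ z ∈ W, t z ∧ 4 * ∑ z ∈ W, t z ≤ (∑ z ∈ W, n z) ^ 2 := by
    refine ⟨Finset.sum_nonneg fun z _ => ht z, ?_⟩
    rw [Finset.mul_sum]
    exact (Finset.sum_le_sum fun z hz => (hWmem z hz).2).trans
      (sum_sq_le_sq_sum W n fun z _ => hn z)
  have hdB : ∑ z ∈ B, t z ≤ B.card * (P * Q) ∧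
      4 * (B.card * (P * Q)) ≤ 4 * ∑ z ∈ B, t z + (∑ z ∈ B, n z) ^ 2 := by
    constructor
    · have := Finset.sum_le_card_nsmul B t (P * Q) fun z _ => htle z
      rwa [nsmul_eq_mul] at this
    · have h1 := sum_sq_le_sq_sum B n fun z _ => hn z
      have h2 : ∑ _z ∈ B, 4 * (P * Q) ≤ ∑ z ∈ B, (4 * t z + n z ^ 2) :=
        Finset.sum_le_sum fun z hz => (hBmem z hz).2
      rw [Finset.sum_const, nsmul_eq_mul, Finset.sum_add_distrib, ← Finset.mul_sum] at h2
      linarith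
  have htS := hsplit t
  rcases Nat.eq_zero_or_pos X.card with hX0 | hXpos
  · left
    have hXe : X = ∅ := Finset.card_eq_zero.1 hX0
    rw [hXe, Finset.sum_empty] at hNs htS
    have hX0' : (X.card : ℤ) = 0 := by exact_mod_cast hX0
    -- With no slice in `X`, the bounds on `W.card` and `B.card` make both close to balanced, so
    -- each unit of `m` or `m'` costs about `P / 8` of the budget `E ≤ P`.
    have h8 : m + m' ≤ 8 := by
      by_contra! h
      have e1 : m * (P - 32) ≤ m * (2 * (4 * W.card - m)) :=
        mul_le_mul_of_nonneg_left (by linarith) hm0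
      have e2 : m' * (P - 32) ≤ m' * (2 * (4 * B.card - m')) :=
        mul_le_mul_of_nonneg_left (by linarith) hm0'
      have e3 : 9 * (P - 32) ≤ (m + m') * (P - 32) :=
        mul_le_mul_of_nonneg_right (by linarith) (by linarith)
      linarith
    have hsq : m ^ 2 + m' ^ 2 ≤ 64 := by
      linarith [mul_nonneg hm0 hm0', pow_le_pow_left₀ (add_nonneg hm0 hm0') h8 2]
    have hS : ∑ z ∈ W, n z + ∑ z ∈ B, n z ≤ E + 16 := by linarith
    have hSsq : (∑ z ∈ W, n z + ∑ z ∈ B, n z) ^ 2 ≤ (E + 16) ^ 2 :=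
      pow_le_pow_left₀ (add_nonneg hSW0 hSB0) hS 2
    -- The slab consists of the `B` slices. The error is at most a quarter of the squared number of
    -- mixed lines in the slices, which is at most `E + 16` since `V ≥ P Q - 16`.
    refine ⟨by linarith, B.card, ∑ z ∈ W, t z + ∑ z ∈ B, t z - B.card * (P * Q),
      by rw [htS]; ring, ?_⟩
    have h4 : |4 * (∑ z ∈ W, t z + ∑ z ∈ B, t z - B.card * (P * Q))| ≤ (E + 16) ^ 2 := by
      rw [abs_le]
      constructor <;> linarith [mul_nonneg hSW0 hSB0, hdW.1, hdW.2, hdB.1, hdB.2,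
        sq_nonneg (∑ z ∈ W, n z), sq_nonneg (∑ z ∈ B, n z)]
    rwa [abs_mul] at h4
  -- One slice of `X` already spends the whole budget: it is the only one, has exactly `P` mixed
  -- lines, and all other slices are monochromatic. The volume is then decided modulo `P Q` by this
  -- slice.
  · have hX1 : (1 : ℤ) ≤ X.card := by exact_mod_cast hXpos
    have hPX : P ≤ X.card * P := le_mul_of_one_le_left hP0.le hX1
    have hPE : P ≤ E := by linarith
    have hXP : X.card * P ≤ P := by linarith
    have hXone : X.card = 1 := by
      have : (X.card : ℤ) ≤ 1 := by
        by_contra! h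
        have h2 : (2 : ℤ) * P ≤ X.card * P := mul_le_mul_of_nonneg_right h hP0.le
        linarith
      exact_mod_cast le_antisymm this hX1
    have hmz : m = 0 := by
      by_contra h
      have : 0 < m := lt_of_le_of_ne hm0 (Ne.symm h)
      linarith [mul_pos this (show (0:ℤ) < P - m by linarith)]
    have hmz' : m' = 0 := by
      by_contra h
      have : 0 < m' := lt_of_le_of_ne hm0' (Ne.symm h)
      linarith [mul_pos this (show (0:ℤ) < P - m' by linarith)]
    rw [hmz, hmz'] at hVge
    have hSWz : ∑ z ∈ W, n z = 0 := by linarith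
    have hSBz : ∑ z ∈ B, n z = 0 := by linarith
    rw [hSWz] at hdW
    rw [hSBz] at hdB
    obtain ⟨z₀, hz₀⟩ := Finset.card_eq_one.1 hXone
    rw [hz₀, Finset.sum_singleton] at hNs htS
    have hnz : n z₀ = P := le_antisymm (by linarith) (hXmem z₀ (by simp [hz₀]))
    have htot : ∑ z, t z = P * Q * B.card + t z₀ := by
      rw [htS]; linarith [hdW.1, hdW.2, hdB.1, hdB.2]
    have hsq : P ^ 2 ≤ (E + 16) ^ 2 := pow_le_pow_left₀ hP0.le (by linarith) 2
    rcases halt z₀ with h | h | h | h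
    · linarith
    · right
      refine ⟨hPE, ?_⟩
      rw [htot]
      exact dvd_add (Dvd.intro _ (mul_assoc P Q _).symm) h.2
    · left
      refine ⟨by linarith, _, _, htot, ?_⟩
      rw [hnz] at h
      rw [abs_of_nonneg (ht z₀)]
      linarith
    · left
      refine ⟨by linarith, B.card + 1, t z₀ - P * Q, by rw [htot]; ring, ?_⟩
      rw [hnz] at h
      rw [abs_of_nonpos (by linarith [htle z₀])]
      linarith

/-- If no slice is mostly of the second colour, all slices are mixed. -/
theorem all_slices_mixed {ι : Type*} [Fintype ι] [Nonempty ι] {n t : ι → ℤ} {P Q R V : ℤ}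
    (hP : 1000 ≤ P) (hPQ : P ≤ Q) (hR : (Fintype.card ι : ℤ) = R) (hQR : Q ≤ R)
    (hn : ∀ z, 0 ≤ n z)
    (halt : ∀ z, P ≤ n z ∨ 4 * t z ≤ n z ^ 2)
    (hV : ∀ z z', t z' ≤ t z + V) (hN : V + ∑ z, n z ≤ P * Q + P)
    (hvol : R * (P * Q) - 2 * (P * Q) ≤ 2 * ∑ z, t z) (z : ι) : P ≤ n z := by
  by_contra! hz
  obtain ⟨z₁, -, hmin⟩ := Finset.exists_min_image Finset.univ n Finset.univ_nonempty
  obtain ⟨z₂, -, hmax⟩ := Finset.exists_max_image Finset.univ t Finset.univ_nonempty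
  set m := n z₁
  set u := t z₂
  have hm0 : 0 ≤ m := hn z₁
  have hmP : m < P := lt_of_le_of_lt (hmin z (Finset.mem_univ z)) hz
  have ht1 : 4 * t z₁ ≤ m ^ 2 := (halt z₁).resolve_left (not_le.2 hmP)
  have hVu := hV z₁ z₂
  have hP0 : 0 < P := by linarith
  have hQ0 : 0 < Q := by linarith
  have hPP : P * P ≤ P * Q := mul_le_mul_of_nonneg_left hPQ hP0.le
  -- The spread of the slice areas, multiplied by four; it is paid for by vertical mixed lines.
  set D := 4 * u - m ^ 2 with hD
  have hDV : D ≤ 4 * V := by linarith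
  have hu : R * (P * Q) - 2 * (P * Q) ≤ 2 * (R * u) := by
    have : ∑ z, t z ≤ R * u := by
      have := Finset.sum_le_card_nsmul Finset.univ t u fun z hz => hmax z hz
      rwa [nsmul_eq_mul, Finset.card_univ, hR] at this
    linarith
  have hRpos : 0 < R := by linarith
  have hu' : P * Q ≤ 4 * u := by
    by_contra! h
    nlinarith [mul_pos hRpos (show (0:ℤ) < P * Q - 4 * u by linarith), mul_pos hP0 hQ0]
  have hDpos : P ^ 2 - m ^ 2 ≤ D := by rw [hD]; nlinarith
  have hD0 : 0 < D := by nlinarith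
  -- The least `n` for a given `t` grows like `2 √t` up to the value `P`. This concave profile lies
  -- above the chord from `(m ^ 2 / 4, m)` to `(u, P)`, and a linear bound can be summed against the
  -- volume.
  have hchord : ∀ z, D * m + (P - m) * (4 * t z - m ^ 2) ≤ D * n z := by
    intro z
    rcases halt z with h | h
    · have h1 : 4 * t z - m ^ 2 ≤ D := by rw [hD]; linarith [hmax z (Finset.mem_univ z)]
      have h2 := mul_le_mul_of_nonneg_left h1 (show 0 ≤ P - m by linarith)
      have h3 := mul_le_mul_of_nonneg_left h hD0.le
      linarith
    · have hmn := hmin z (Finset.mem_univ z)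
      by_cases hnP : n z ≤ P
      · have h1 : (P - m) * (4 * t z - m ^ 2) ≤ (P - m) * (n z ^ 2 - m ^ 2) :=
          mul_le_mul_of_nonneg_left (by linarith) (by linarith)
        have h2 : (P - m) * (n z + m) ≤ (P - m) * (P + m) :=
          mul_le_mul_of_nonneg_left (by linarith) (by linarith)
        have h3 : (n z - m) * ((P - m) * (n z + m)) ≤ (n z - m) * D :=
          mul_le_mul_of_nonneg_left (by nlinarith) (by linarith)
        nlinarith
      · have h1 : 4 * t z - m ^ 2 ≤ D := by rw [hD]; linarith [hmax z (Finset.mem_univ z)]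
        have h2 := mul_le_mul_of_nonneg_left h1 (show 0 ≤ P - m by linarith)
        have h3 := mul_le_mul_of_nonneg_left (not_le.1 hnP).le hD0.le
        linarith
  have hsum : R * (D * m) + (P - m) * (4 * ∑ z, t z - R * m ^ 2) ≤ D * ∑ z, n z := by
    have h := Finset.sum_le_sum fun z (_ : z ∈ Finset.univ) => hchord z
    rw [Finset.sum_add_distrib, ← Finset.mul_sum, ← Finset.mul_sum, Finset.sum_sub_distrib,
      ← Finset.mul_sum] at h
    simp only [Finset.sum_const, nsmul_eq_mul, Finset.card_univ, hR] at h
    rw [← Finset.mul_sum] at h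
    linarith
  have h1 : (P - m) * (R * (2 * (P * Q) - m ^ 2) - 4 * (P * Q)) ≤
      (P - m) * (4 * ∑ z, t z - R * m ^ 2) :=
    mul_le_mul_of_nonneg_left (by linarith) (by linarith)
  have hF : 0 ≤ 2 * (P * Q) - m ^ 2 := by nlinarith
  have h2 : Q * (D * m + (P - m) * (2 * (P * Q) - m ^ 2)) ≤
      R * (D * m + (P - m) * (2 * (P * Q) - m ^ 2)) :=
    mul_le_mul_of_nonneg_right hQR
      (add_nonneg (mul_nonneg hD0.le hm0) (mul_nonneg (by linarith) hF))
  have h3 : D * (V + ∑ z, n z) ≤ D * (P * Q + P) := mul_le_mul_of_nonneg_left hN hD0.le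
  have h4 : D * D ≤ D * (4 * V) := mul_le_mul_of_nonneg_left hDV hD0.le
  set y := (P - m) * Q with hy
  have hyQ : Q ≤ y := by nlinarith
  -- The energy bound is now quadratic in `D`. Its discriminant is negative by `h7` and `h8`, so
  -- completing the square gives the contradiction.
  have h5 : D * D - 4 * D * (y + P) + 4 * y * (2 * (P * Q) - m ^ 2 - 4 * P) ≤ 0 := by
    rw [hy]; nlinarith
  have h6 : y + P * Q ≤ 2 * (P * Q) - m ^ 2 := by
    rw [hy]; nlinarith
  have h7 : y * (y + P * Q - 4 * P) ≤ y * (2 * (P * Q) - m ^ 2 - 4 * P) :=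
    mul_le_mul_of_nonneg_left (by linarith) (by linarith)
  have h8 : P * P < y * (P * Q - 6 * P) := by
    have h9 : P * 2 ≤ P * Q - 6 * P := by
      linarith [mul_nonneg hP0.le (show (0 : ℤ) ≤ Q - 8 by linarith)]
    have h10 : Q * (P * 2) ≤ y * (P * Q - 6 * P) :=
      mul_le_mul hyQ h9 (by linarith) (by linarith)
    linarith [mul_pos hP0 hQ0]
  linarith [sq_nonneg (D - 2 * (y + P))]

/-- If the slices have few mixed lines in total, some slice is mostly of the second colour. -/
theorem exists_majority {ι : Type*} [Fintype ι] {n t : ι → ℤ} {P Q R : ℤ}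
    (hP : 0 < P) (hPQ : P ≤ Q) (hn : ∀ z, 0 ≤ n z) (htle : ∀ z, t z ≤ P * Q)
    (halt : ∀ z, P ≤ n z ∨ 4 * t z ≤ n z ^ 2 ∨ 4 * (P * Q) ≤ 4 * t z + n z ^ 2)
    (hS : 2 * ∑ z, n z < (R - 2) * P)
    (hvol : R * (P * Q) - 2 * (P * Q) ≤ 2 * ∑ z, t z) :
    ∃ z, n z < P ∧ 4 * (P * Q) ≤ 4 * t z + n z ^ 2 := by
  by_contra! hc
  -- Without a nearly full slice every cell can be charged to mixed lines at a rate of at most `Q`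
  -- per line, which leaves too small a volume.
  have h : ∀ z, t z ≤ Q * n z := by
    intro z
    by_cases hz : P ≤ n z
    · have := mul_le_mul_of_nonneg_left hz (show 0 ≤ Q by linarith)
      linarith [htle z]
    · push Not at hz
      have h1 := hc z hz
      rcases halt z with h2 | h2 | h2
      · linarith
      · have h3 : n z * n z ≤ Q * n z := mul_le_mul_of_nonneg_right (by linarith) (hn z)
        have h4 : 0 ≤ Q * n z := mul_nonneg (by linarith) (hn z)
        linarith
      · linarith
  have h1 : ∑ z, t z ≤ Q * ∑ z, n z := by
    rw [Finset.mul_sum]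
    exact Finset.sum_le_sum fun z _ => h z
  have h2 : Q * (2 * ∑ z, n z) < Q * ((R - 2) * P) := mul_lt_mul_of_pos_left hS (by linarith)
  linarith

/-! ### Solid regions and their horizontal slices -/

section Solid

variable {α β γ : Type*} [Fintype α] [Fintype β]

/-- The horizontal slice of a solid region at height `z`. -/
def slice (A : α → β → γ → Bool) (z : γ) : α → β → Bool := fun x y => A x y z

/-- The number of cells of a solid region. -/
def solidVolume [Fintype γ] (A : α → β → γ → Bool) : ℕ := ∑ z, area (slice A z)

/-- The number of lines in the first direction on which `A` is not constant. -/
noncomputable def mixedX {α β γ : Type*} [Fintype β] [Fintype γ] (A : α → β → γ → Bool) : ℕ :=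
  ∑ z, mixedCols (slice A z)

/-- The number of lines in the second direction on which `A` is not constant. -/
noncomputable def mixedY {α β γ : Type*} [Fintype α] [Fintype γ] (A : α → β → γ → Bool) : ℕ :=
  ∑ z, mixedRows (slice A z)

/-- The number of lines in the third direction on which `A` is not constant. -/
noncomputable def mixedZ (A : α → β → γ → Bool) : ℕ :=
  ∑ x, ∑ y, mixedInd (A x y)

theorem area_slice_le (A : α → β → γ → Bool) (z z' : γ) :
    area (slice A z') ≤ area (slice A z) + mixedZ A := by
  unfold area mixedZ
  rw [← Finset.sum_add_distrib]
  refine Finset.sum_le_sum fun x _ => ?_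
  rw [← Finset.sum_add_distrib]
  exact Finset.sum_le_sum fun y _ => toNat_le_add_mixedInd (A x y) z' z

theorem area_le (S : α → β → Bool) : area S ≤ Fintype.card α * Fintype.card β := by
  have := area_add_area_not S
  omega

/-- Many lines are full in a region almost all of whose columns are constant. -/
theorem le_card_full {S : α → β → Bool} [Nonempty α] {g k : ℕ} (hk : mixedCols S ≤ k)
    (hg : Fintype.card α * (g + k) ≤ area S) :
    g ≤ (Finset.univ.filter fun y => ∀ x, S x y = true).card := by
  classical
  set F := Finset.univ.filter fun y => ∀ x, S x y = true with hF
  have h : area S ≤ Fintype.card α * (F.card + mixedCols S) := by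
    rw [← area_flip, area, mixedCols, Finset.card_filter, ← Finset.sum_add_distrib, Finset.mul_sum]
    refine Finset.sum_le_sum fun y _ => ?_
    have hle : ∑ x, (S x y).toNat ≤ Fintype.card α := by
      calc ∑ x, (S x y).toNat ≤ ∑ _x : α, 1 := Finset.sum_le_sum fun x _ => Bool.toNat_le _
        _ = _ := by simp
    by_cases hm : Mixed fun x => S x y
    · rw [mixedInd_eq_one hm]
      exact hle.trans (Nat.le_mul_of_pos_right _ (by omega))
    · by_cases hf : ∀ x, S x y = true
      · rw [if_pos hf]
        exact hle.trans (Nat.le_mul_of_pos_right _ (by omega))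
      · push Not at hf
        obtain ⟨x₀, hx₀⟩ := hf
        have : ∀ x, S x y = false := fun x =>
          (eq_of_not_mixed hm x x₀).trans (by simpa using hx₀)
        simp [this]
  have h2 : g + k ≤ F.card + mixedCols S :=
    Nat.le_of_mul_le_mul_left (hg.trans h) Fintype.card_pos
  omega

/-- If one slice is a strip, then every constant row of any other slice meets many mixed vertical
lines. -/
theorem strip_rigidity [Nonempty α] (A : α → β → γ → Bool) (z₀ z : γ) {g k : ℕ}
    (hk : mixedCols (slice A z₀) ≤ k)
    (h₁ : Fintype.card α * (g + k) ≤ area (slice A z₀))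
    (h₂ : Fintype.card α * (g + k) + area (slice A z₀) ≤ Fintype.card α * Fintype.card β) :
    Fintype.card α * g ≤ mixedZ A + g * mixedRows (slice A z) := by
  classical
  have hfull := le_card_full hk h₁
  have hempty := le_card_full (S := fun x y => !slice A z₀ x y) (g := g) (k := k)
    (by rwa [mixedCols_not]) (by have := area_add_area_not (slice A z₀); omega)
  -- A constant row of slice `z` disagrees with the strip either over all its empty lines or over
  -- all its full lines; each disagreement is a mixed vertical line.
  have key : ∀ x, g ≤ ∑ y, mixedInd (A x y) + g * mixedInd (slice A z x) := by
    intro x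
    by_cases hm : Mixed (slice A z x)
    · rw [mixedInd_eq_one hm]; omega
    · have hF : ∀ F : Finset β, (∀ y ∈ F, Mixed (A x y)) → F.card ≤ ∑ y, mixedInd (A x y) := by
        intro F hF
        calc F.card = ∑ y ∈ F, mixedInd (A x y) := by
              rw [Finset.card_eq_sum_ones]
              exact Finset.sum_congr rfl fun y hy => (mixedInd_eq_one (hF y hy)).symm
          _ ≤ _ := Finset.sum_le_sum_of_subset (Finset.subset_univ F)
      by_cases ht : ∃ y, slice A z x y = true
      · obtain ⟨y₁, hy₁⟩ := ht
        refine (hempty.trans (hF _ fun y hy => ⟨z, z₀, ?_⟩)).trans (Nat.le_add_right _ _)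
        have h1 : slice A z x y = true := (eq_of_not_mixed hm y y₁).trans hy₁
        have h2 : slice A z₀ x y = false := by simpa using (Finset.mem_filter.1 hy).2 x
        simp only [slice] at h1 h2
        simp [h1, h2]
      · push Not at ht
        refine (hfull.trans (hF _ fun y hy => ⟨z, z₀, ?_⟩)).trans (Nat.le_add_right _ _)
        have h1 : slice A z x y = false := by simpa using ht y
        have h2 : slice A z₀ x y = true := (Finset.mem_filter.1 hy).2 x
        simp only [slice] at h1 h2
        simp [h1, h2]
  have := Finset.sum_le_sum fun x (_ : x ∈ Finset.univ) => key x
  rw [Finset.sum_add_distrib, ← Finset.mul_sum] at this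
  simpa [mixedZ, mixedRows] using this

theorem solidVolume_swap_right [Fintype γ] (A : α → β → γ → Bool) :
    solidVolume (fun x z y => A x y z) = solidVolume A := by
  simp only [solidVolume, area, slice]
  rw [Finset.sum_comm]
  simp_rw [Finset.sum_comm (s := (Finset.univ : Finset β)) (t := (Finset.univ : Finset γ))]
  rw [Finset.sum_comm]

theorem solidVolume_rotate [Fintype γ] (A : α → β → γ → Bool) :
    solidVolume (fun y z x => A x y z) = solidVolume A := by
  simp only [solidVolume, area, slice]
  simp_rw [Finset.sum_comm (s := (Finset.univ : Finset β)) (t := (Finset.univ : Finset γ))]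
  rw [Finset.sum_comm]

/-- The slices of `A` satisfy the planar alternative. -/
theorem slice_alternative (A : α → β → γ → Bool) (hab : Fintype.card α ≤ Fintype.card β) (z : γ) :
    let n : ℤ := ((mixedRows (slice A z) + mixedCols (slice A z) : ℕ) : ℤ)
    let t : ℤ := area (slice A z)
    let P : ℤ := Fintype.card α
    let Q : ℤ := Fintype.card β
    P < n ∨ (n = P ∧ P ∣ t) ∨ 4 * t ≤ n ^ 2 ∨ 4 * (P * Q) ≤ 4 * t + n ^ 2 := by
  intro n t P Q
  simp only [n, t, P, Q]
  rcases planar_alternative (slice A z) hab with h | ⟨h, h'⟩ | h | h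
  · left; exact_mod_cast h
  · right; left; exact ⟨by exact_mod_cast h, by exact_mod_cast h'⟩
  · right; right; left; exact_mod_cast h
  · right; right; right; exact_mod_cast h

theorem sum_mixed_slice [Fintype γ] (A : α → β → γ → Bool) :
    ∑ z, ((mixedRows (slice A z) + mixedCols (slice A z) : ℕ) : ℤ) =
      (mixedX A : ℤ) + mixedY A := by
  rw [mixedX, mixedY, ← Nat.cast_sum, Finset.sum_add_distrib]
  push_cast
  ring

theorem sum_area_slice [Fintype γ] (A : α → β → γ → Bool) :
    ∑ z, (area (slice A z) : ℤ) = solidVolume A := by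
  rw [solidVolume, Nat.cast_sum]

/-- A region with few mixed lines in the first two directions has nearly the volume of a slab. -/
theorem solidVolume_of_few_mixed [Fintype γ] (A : α → β → γ → Bool) {P Q R E : ℤ}
    (hα : (Fintype.card α : ℤ) = P) (hβ : (Fintype.card β : ℤ) = Q)
    (hγ : (Fintype.card γ : ℤ) = R) (hP : 1000 ≤ P) (hPQ : P ≤ Q) (hPR : P ≤ R + 1) (hEP : E ≤ P)
    (hN : (mixedX A + mixedY A + mixedZ A : ℤ) ≤ P * Q + E)
    (hS : 2 * (mixedX A + mixedY A : ℤ) < (R - 2) * P)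
    (hvol₁ : R * (P * Q) - 2 * (P * Q) ≤ 2 * solidVolume A)
    (hvol₂ : 2 * (solidVolume A : ℤ) ≤ R * (P * Q) + 2 * (P * Q)) :
    (0 ≤ E ∧ ∃ v d : ℤ, (solidVolume A : ℤ) = P * Q * v + d ∧ 4 * |d| ≤ (E + 16) ^ 2) ∨
      (P ≤ E ∧ P ∣ (solidVolume A : ℤ)) := by
  have hab : Fintype.card α ≤ Fintype.card β := by
    have : (Fintype.card α : ℤ) ≤ Fintype.card β := by rw [hα, hβ]; exact hPQ
    exact_mod_cast this
  have halt := slice_alternative A hab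
  have htle : ∀ z, (area (slice A z) : ℤ) ≤ P * Q := fun z => by
    rw [← hα, ← hβ]; exact_mod_cast area_le (slice A z)
  simp only [hα, hβ] at halt
  rw [← sum_area_slice] at hvol₁ hvol₂ ⊢
  rw [← sum_mixed_slice] at hS hN
  have halt' : ∀ z, P ≤ ((mixedRows (slice A z) + mixedCols (slice A z) : ℕ) : ℤ) ∨
      4 * (area (slice A z) : ℤ) ≤ ((mixedRows (slice A z) + mixedCols (slice A z) : ℕ) : ℤ) ^ 2 ∨
      4 * (P * Q) ≤ 4 * (area (slice A z) : ℤ) +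
        ((mixedRows (slice A z) + mixedCols (slice A z) : ℕ) : ℤ) ^ 2 := fun z => by
    rcases halt z with h | h | h
    · exact Or.inl h.le
    · exact Or.inl h.1.ge
    · exact Or.inr h
  refine slab_volume hP hPQ hγ hPR hEP (fun z => Nat.cast_nonneg _) (fun z => Nat.cast_nonneg _)
    htle halt (V := mixedZ A) (fun z z' => by exact_mod_cast area_slice_le A z z')
    (by linarith) hvol₁ hvol₂ ?_ ?_
  -- The nearly empty slice is found by exchanging the colours.
  · obtain ⟨z, hz, hz'⟩ := exists_majority (t := fun z => P * Q - (area (slice A z) : ℤ))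
      (by linarith) hPQ (fun z => Nat.cast_nonneg _) (fun z => by
        have : (0 : ℤ) ≤ area (slice A z) := Nat.cast_nonneg _
        linarith) (fun z => by
        rcases halt' z with h | h | h
        · exact Or.inl h
        · exact Or.inr (Or.inr (by linarith))
        · exact Or.inr (Or.inl (by linarith))) hS (by
        rw [Finset.sum_sub_distrib, Finset.sum_const, nsmul_eq_mul, Finset.card_univ, hγ]
        linarith)
    exact ⟨z, hz, by linarith⟩
  · exact exists_majority (by linarith) hPQ (fun z => Nat.cast_nonneg _) htle halt' hS hvol₁

end Solid

/-! ### Cutting in other directions, strips, and the bound on mixed lines -/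

section Solid

variable {α β γ : Type*}

theorem mixedX_swap_right [Fintype β] [Fintype γ] (A : α → β → γ → Bool) :
    mixedX (fun x z y => A x y z) = mixedX A := by
  simp only [mixedX, mixedCols, slice]
  exact Finset.sum_comm

theorem mixedY_swap_right [Fintype α] [Fintype β] (A : α → β → γ → Bool) :
    mixedY (fun x z y => A x y z) = mixedZ A := by
  simp only [mixedY, mixedRows, mixedZ]
  exact Finset.sum_comm

theorem mixedZ_swap_right [Fintype α] [Fintype γ] (A : α → β → γ → Bool) :
    mixedZ (fun x z y => A x y z) = mixedY A := by
  simp only [mixedY, mixedRows, mixedZ]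
  exact Finset.sum_comm

theorem mixedX_rotate [Fintype α] [Fintype γ] (A : α → β → γ → Bool) :
    mixedX (fun y z x => A x y z) = mixedY A := by
  simp only [mixedX, mixedY, mixedCols, mixedRows, slice]
  exact Finset.sum_comm

theorem mixedY_rotate [Fintype α] [Fintype β] (A : α → β → γ → Bool) :
    mixedY (fun y z x => A x y z) = mixedZ A := rfl

theorem mixedZ_rotate [Fintype β] [Fintype γ] (A : α → β → γ → Bool) :
    mixedZ (fun y z x => A x y z) = mixedX A := by
  simp only [mixedX, mixedZ, mixedCols, slice]
  exact Finset.sum_comm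

theorem mixedZ_swap_left [Fintype α] [Fintype β] (A : α → β → γ → Bool) :
    mixedZ (fun y x z => A x y z) = mixedZ A := by
  simp only [mixedZ]
  exact Finset.sum_comm

/-- If all horizontal slices of a region of low energy are mixed, one of them is a strip. -/
theorem exists_strip {ι : Type*} [Fintype ι] [Nonempty ι] {n t : ι → ℤ} {K L M V : ℤ}
    (hK : 1000 ≤ K) (hKL : K ≤ L) (hLM : L ≤ M) (hM : (Fintype.card ι : ℤ) = M)
    (hall : ∀ z, K ≤ n z) (hV : ∀ z z', t z' ≤ t z + V)
    (hN : V + ∑ z, n z ≤ K * L + K)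
    (hvol₁ : M * (K * L) - 2 * (K * L) ≤ 2 * ∑ z, t z)
    (hvol₂ : 2 * ∑ z, t z ≤ M * (K * L) + 2 * (K * L)) :
    V ≤ K ∧ M ≤ L + 1 ∧
      ∃ z, n z ≤ K + 1 ∧ K * L - 4 * K ≤ 2 * t z ∧ 2 * t z ≤ K * L + 4 * K := by
  have hV0 : 0 ≤ V := by
    obtain ⟨z⟩ := ‹Nonempty ι›
    linarith [hV z z]
  have hsum : M * K ≤ ∑ z, n z := by
    have := Finset.card_nsmul_le_sum Finset.univ n K fun z _ => hall z
    rwa [nsmul_eq_mul, Finset.card_univ, hM] at this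
  have hML : L * K ≤ M * K := mul_le_mul_of_nonneg_right hLM (by linarith)
  have hVK : V ≤ K := by linarith
  have hM0 : 0 < M := by linarith
  refine ⟨hVK, ?_, ?_⟩
  · by_contra! h
    have : (L + 2) * K ≤ M * K := mul_le_mul_of_nonneg_right (by linarith) (by linarith)
    linarith
  · obtain ⟨z, hz⟩ : ∃ z, n z ≤ K + 1 := by
      by_contra! h
      have : M * (K + 2) ≤ ∑ z, n z := by
        have := Finset.card_nsmul_le_sum Finset.univ n (K + 2) fun z _ => by linarith [h z]
        rwa [nsmul_eq_mul, Finset.card_univ, hM] at this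
      linarith
    -- All slice areas agree up to `V ≤ K`, so each is close to the average, which the volume puts
    -- near `K L / 2`.
    have hMV : M * V ≤ M * K := mul_le_mul_of_nonneg_left hVK hM0.le
    refine ⟨z, hz, ?_, ?_⟩
    · have h1 : ∑ z', t z' ≤ M * (t z + V) := by
        have := Finset.sum_le_card_nsmul Finset.univ t (t z + V) fun z' _ => hV z z'
        rwa [nsmul_eq_mul, Finset.card_univ, hM] at this
      have h2 : M * (K * L - 4 * K) ≤ M * (2 * t z) := by linarith
      exact le_of_mul_le_mul_left h2 hM0
    · have h1 : M * (t z - V) ≤ ∑ z', t z' := by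
        have := Finset.card_nsmul_le_sum Finset.univ t (t z - V) fun z' _ => by linarith [hV z' z]
        rwa [nsmul_eq_mul, Finset.card_univ, hM] at this
      have h2 : M * (2 * t z) ≤ M * (K * L + 4 * K) := by linarith
      exact le_of_mul_le_mul_left h2 hM0

/-- A planar region of medium area with few mixed lines is a strip. -/
theorem strip_of_few_mixed [Fintype α] [Fintype β] (S : α → β → Bool) {K L : ℕ}
    (hα : Fintype.card α = K)
    (hβ : Fintype.card β = L) (hK : 1000 ≤ K) (hKL : K ≤ L)
    (hn : mixedRows S + mixedCols S ≤ K + 1) (h₁ : K * L ≤ 2 * area S + 4 * K)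
    (h₂ : 2 * area S ≤ K * L + 4 * K) :
    mixedCols S ≤ 1 ∨ (mixedRows S ≤ 1 ∧ L ≤ K + 1) := by
  have hr := mixedRows_le S
  have hc := mixedCols_le S
  rw [hα] at hr
  rw [hβ] at hc
  by_cases hr' : mixedRows S = K
  · left; omega
  by_cases hc' : mixedCols S = L
  · right; omega
  exfalso
  have hsq : 4 * (mixedRows S * mixedCols S) ≤ (K + 1) ^ 2 := by
    have h1 := four_mul_le_sq_add (mixedRows S : ℕ) (mixedCols S)
    have h2 := Nat.pow_le_pow_left hn 2
    linarith
  have hKK : K * K ≤ K * L := Nat.mul_le_mul_left K hKL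
  have hbig : K * 1000 ≤ K * K := Nat.mul_le_mul_left K hK
  rcases area_le_mul_or S (by omega) (by omega) with h | h
  · nlinarith
  · rw [hα, hβ] at h
    nlinarith

/-- In a low stack over a strip all slices are mixed in the direction of the strip. -/
theorem mixedY_ge_of_strip [Fintype α] [Fintype β] [Fintype γ] [Nonempty α] (A : α → β → γ → Bool)
    (z₀ : γ) {a b c : ℕ}
    (hα : Fintype.card α = a) (hβ : Fintype.card β = b) (hγ : Fintype.card γ = c)
    (ha : 1000 ≤ a) (hab : a ≤ b + 1) (hZ : mixedZ A ≤ b + 1)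
    (hk : mixedCols (slice A z₀) ≤ 1)
    (h₁ : a * b ≤ 2 * area (slice A z₀) + 6 * a) (h₂ : 2 * area (slice A z₀) ≤ a * b + 6 * a) :
    c * a ≤ mixedY A + 2 * c := by
  have hg : 2 * (b / 2) ≤ b := Nat.mul_div_le b 2
  -- The strip has about `b / 2` full and `b / 2` empty lines; the loss of 4 absorbs the error `6 a`
  -- and the mixed column. Three constant rows would need `3 g > b + 1` vertical mixed lines.
  obtain ⟨g, hg⟩ : ∃ g, g + 4 = b / 2 := ⟨b / 2 - 4, by omega⟩
  have hgb : a * (2 * g + 8) ≤ a * b := Nat.mul_le_mul_left a (by omega)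
  have hrig : ∀ z, a ≤ mixedRows (slice A z) + 2 := by
    intro z
    have h := strip_rigidity A z₀ z (g := g) hk (by rw [hα]; linarith) (by rw [hα, hβ]; linarith)
    rw [hα] at h
    by_contra! hlt
    have h3 : (mixedRows (slice A z) + 3) * g ≤ a * g := Nat.mul_le_mul_right g (by omega)
    have h4 : 3 * g ≤ mixedZ A := by linarith
    omega
  have := Finset.sum_le_sum fun z (_ : z ∈ Finset.univ) => hrig z
  rw [Finset.sum_add_distrib] at this
  simp only [Finset.sum_const, Finset.card_univ, hγ, smul_eq_mul] at this
  rw [mixedY]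
  linarith

/-- A region whose volume is about half of the box and not close to that of a slab has more than
`K L + K` mixed lines. -/
theorem mixed_lines_lower_bound [Fintype α] [Fintype β] [Fintype γ] (A : α → β → γ → Bool)
    {K L M : ℕ} (hα : Fintype.card α = K)
    (hβ : Fintype.card β = L) (hγ : Fintype.card γ = M)
    (hK : 1000 ≤ K) (hKL : K ≤ L) (hLM : L ≤ M)
    (hvol₁ : (M : ℤ) * (K * L) - 2 * (K * L) ≤ 2 * solidVolume A)
    (hvol₂ : 2 * (solidVolume A : ℤ) ≤ M * (K * L) + 2 * (K * L))
    (hslab : ∀ v d : ℤ, (solidVolume A : ℤ) = K * L * v + d → ((K : ℤ) + 16) ^ 2 < 4 * |d|)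
    (hdvd : ¬ (K : ℤ) ∣ solidVolume A)
    (hslab' : M = L + 1 → ∀ v d : ℤ, (solidVolume A : ℤ) = K * M * v + d → 256 < 4 * |d|) :
    K * L + K < mixedX A + mixedY A + mixedZ A := by
  by_contra! hle
  have hαne : Nonempty α := Fintype.card_pos_iff.1 (by omega)
  have hβne : Nonempty β := Fintype.card_pos_iff.1 (by omega)
  have hγne : Nonempty γ := Fintype.card_pos_iff.1 (by omega)
  have hK' : (1000 : ℤ) ≤ K := by exact_mod_cast hK
  have hKL' : (K : ℤ) ≤ L := by exact_mod_cast hKL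
  have hLM' : (L : ℤ) ≤ M := by exact_mod_cast hLM
  have hle' : (mixedX A + mixedY A + mixedZ A : ℤ) ≤ K * L + K := by exact_mod_cast hle
  have halt := slice_alternative A (by omega)
  simp only [hα, hβ] at halt
  set n : γ → ℤ := fun z => ((mixedRows (slice A z) + mixedCols (slice A z) : ℕ) : ℤ) with hn
  set t : γ → ℤ := fun z => (area (slice A z) : ℤ) with ht
  have hn0 : ∀ z, 0 ≤ n z := fun z => Nat.cast_nonneg _
  have ht0 : ∀ z, 0 ≤ t z := fun z => Nat.cast_nonneg _
  have htle : ∀ z, t z ≤ K * L := fun z => by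
    have := area_le (slice A z)
    rw [hα, hβ] at this
    change (area (slice A z) : ℤ) ≤ K * L
    exact_mod_cast this
  have hV : ∀ z z', t z' ≤ t z + mixedZ A := fun z z' => by
    change (area (slice A z') : ℤ) ≤ area (slice A z) + mixedZ A
    exact_mod_cast area_slice_le A z z'
  have hγ' : (Fintype.card γ : ℤ) = M := by exact_mod_cast hγ
  have hNs : (mixedZ A : ℤ) + ∑ z, n z ≤ K * L + K := by
    have := sum_mixed_slice A
    rw [← hn] at this
    linarith
  have hts : ∑ z, t z = solidVolume A := sum_area_slice A
  have halt' : ∀ z, (K : ℤ) < n z ∨ (n z = K ∧ (K : ℤ) ∣ t z) ∨ 4 * t z ≤ n z ^ 2 ∨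
    4 * ((K : ℤ) * L) ≤ 4 * t z + n z ^ 2 := halt
  have hall : ∀ z, (K : ℤ) ≤ n z := by
    by_cases hW : ∃ z, n z < K ∧ 4 * t z ≤ n z ^ 2
    · by_cases hB : ∃ z, n z < K ∧ 4 * ((K : ℤ) * L) ≤ 4 * t z + n z ^ 2
      · exfalso
        rcases slab_volume hK' hKL' hγ' (by linarith) le_rfl hn0 ht0 htle halt' hV hNs
          (by rwa [hts]) (by rwa [hts]) hW hB with ⟨-, v, d, h, h'⟩ | ⟨-, h⟩
        · rw [hts] at h
          linarith [hslab v d h]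
        · rw [hts] at h
          exact hdvd h
      · refine all_slices_mixed hK' hKL' hγ' hLM' hn0 (fun z => ?_) hV hNs (by rwa [hts])
        by_cases hz : (K : ℤ) ≤ n z
        · exact Or.inl hz
        · refine Or.inr (((halt' z).resolve_left (by linarith)).resolve_left
            (fun h => hz h.1.ge)|>.resolve_right fun h => hB ⟨z, not_le.1 hz, h⟩)
    -- The same argument with the colours exchanged.
    · refine all_slices_mixed (t := fun z => (K : ℤ) * L - t z) hK' hKL' hγ' hLM' hn0 (fun z => ?_)
        (fun z z' => by linarith [hV z' z]) hNs ?_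
      · by_cases hz : (K : ℤ) ≤ n z
        · exact Or.inl hz
        · have := ((halt' z).resolve_left (by linarith)).resolve_left
            (fun h => hz h.1.ge)|>.resolve_left fun h => hW ⟨z, not_le.1 hz, h⟩
          exact Or.inr (by linarith)
      · rw [Finset.sum_sub_distrib, hts, Finset.sum_const, nsmul_eq_mul, Finset.card_univ, hγ']
        linarith
  obtain ⟨hVK, hML, z₀, hz₀, hz₁, hz₂⟩ := exists_strip hK' hKL' hLM' hγ' hall hV hNs
    (by rwa [hts]) (by rwa [hts])
  have hVK' : mixedZ A ≤ K := by exact_mod_cast hVK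
  have hML' : M ≤ L + 1 := by exact_mod_cast hML
  have hz₀' : mixedRows (slice A z₀) + mixedCols (slice A z₀) ≤ K + 1 := by
    have : ((mixedRows (slice A z₀) + mixedCols (slice A z₀) : ℕ) : ℤ) ≤ K + 1 := hz₀
    exact_mod_cast this
  have hz₁' : K * L ≤ 2 * area (slice A z₀) + 4 * K := by
    have : (K : ℤ) * L ≤ 2 * (area (slice A z₀) : ℤ) + 4 * K := by linarith
    exact_mod_cast this
  have hz₂' : 2 * area (slice A z₀) ≤ K * L + 4 * K := by
    have : 2 * (area (slice A z₀) : ℤ) ≤ K * L + 4 * K := hz₂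
    exact_mod_cast this
  have hLK : (L : ℤ) * K ≤ M * K := mul_le_mul_of_nonneg_right hLM' (by linarith)
  have hLM2 : (L : ℤ) * L ≤ M * L := mul_le_mul_of_nonneg_right hLM' (by linarith)
  have hLK2 : (K : ℤ) * L ≤ M * L := mul_le_mul_of_nonneg_right (by linarith) (by linarith)
  have hKbig : (1000 : ℤ) * L ≤ K * L := mul_le_mul_of_nonneg_right hK' (by linarith)
  have hX0 : (0 : ℤ) ≤ mixedX A := Nat.cast_nonneg _
  have hY0 : (0 : ℤ) ≤ mixedY A := Nat.cast_nonneg _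
  have hZ0 : (0 : ℤ) ≤ mixedZ A := Nat.cast_nonneg _
  rcases strip_of_few_mixed (slice A z₀) hα hβ hK hKL hz₀' hz₁' hz₂' with h1 | ⟨h1, hLK1⟩
  · have hY := mixedY_ge_of_strip A z₀ hα hβ hγ hK (by omega) (by omega) h1
      (by linarith) (by linarith)
    have hY' : (M : ℤ) * K ≤ mixedY A + 2 * M := by exact_mod_cast hY
    -- Slices are now cut across the second direction, whose mixed lines play the role of `V`. The
    -- excess `E = K (L + 1 - M)` is `K` or `0`.
    have hvol := solidVolume_of_few_mixed (fun x z y => A x y z) (P := K) (Q := M) (R := L)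
      (E := K * L + K - K * M) (by exact_mod_cast hα) (by exact_mod_cast hγ) (by exact_mod_cast hβ)
      hK' (by linarith) (by linarith) (by linarith)
      (by rw [mixedX_swap_right A, mixedY_swap_right A, mixedZ_swap_right A]; linarith)
      (by rw [mixedX_swap_right A, mixedY_swap_right A]; linarith)
      (by rw [solidVolume_swap_right A]; linarith) (by rw [solidVolume_swap_right A]; linarith)
    rw [solidVolume_swap_right A] at hvol
    rcases Nat.lt_or_ge L M with hlt | hge
    · have hM1 : M = L + 1 := by omega
      have hM1' : (M : ℤ) = L + 1 := by exact_mod_cast hM1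
      have hE : (K : ℤ) * L + K - K * M = 0 := by rw [hM1']; ring
      rw [hE] at hvol
      rcases hvol with ⟨-, v, d, h, h'⟩ | ⟨h, -⟩
      · linarith [hslab' hM1 v d h]
      · linarith
    · have hML1 : (M : ℤ) = L := by exact_mod_cast le_antisymm hge hLM
      rw [hML1, show (K : ℤ) * L + K - K * L = K by ring] at hvol
      rcases hvol with ⟨-, v, d, h, h'⟩ | ⟨-, h⟩
      · linarith [hslab v d h]
      · exact hdvd h
  · have hLK1' : (L : ℤ) ≤ K + 1 := by exact_mod_cast hLK1
    have hflip : area (slice (fun y x z => A x y z) z₀) = area (slice A z₀) :=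
      area_flip (slice A z₀)
    have hX := mixedY_ge_of_strip (fun y x z => A x y z) z₀ hβ hα hγ (by omega) (by omega)
      (by rw [mixedZ_swap_left A]; omega) h1
      (by rw [hflip]; linarith) (by rw [hflip]; linarith)
    have hX' : (M : ℤ) * L ≤ mixedX A + 2 * M := by exact_mod_cast hX
    have hvol := solidVolume_of_few_mixed (fun y z x => A x y z) (P := L) (Q := M) (R := K)
      (E := K * L + K - L * M) (by exact_mod_cast hβ) (by exact_mod_cast hγ) (by exact_mod_cast hα)
      (by linarith) (by linarith) (by linarith) (by linarith)
      (by rw [mixedX_rotate A, mixedY_rotate A, mixedZ_rotate A]; linarith)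
      (by rw [mixedX_rotate A, mixedY_rotate A]; linarith)
      (by rw [solidVolume_rotate A]; linarith) (by rw [solidVolume_rotate A]; linarith)
    rw [solidVolume_rotate A] at hvol
    -- Both outcomes of the slab estimate contain `E ≥ 0`, and this forces `L = K`, which reduces to
    -- the previous two subcases.
    have hE0 : (0 : ℤ) ≤ K * L + K - L * M := by
      rcases hvol with h | h
      · exact h.1
      · linarith [h.1]
    have hLeqK : (L : ℤ) = K := by
      by_contra hne
      have h2 : (K : ℤ) + 1 ≤ L := by omega
      have : (L : ℤ) * (K + 1) ≤ L * M := mul_le_mul_of_nonneg_left (by linarith) (by linarith)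
      linarith
    rcases Nat.lt_or_ge L M with hlt | hge
    · have hM1 : M = L + 1 := by omega
      have hM1' : (M : ℤ) = L + 1 := by exact_mod_cast hM1
      have hE : (K : ℤ) * L + K - L * M = 0 := by rw [hM1', hLeqK]; ring
      rw [hE] at hvol
      rcases hvol with ⟨-, v, d, h, h'⟩ | ⟨h, -⟩
      · rw [hLeqK] at h
        linarith [hslab' hM1 v d h]
      · linarith
    · have hML1 : (M : ℤ) = L := by exact_mod_cast le_antisymm hge hLM
      rw [hML1, hLeqK, show (K : ℤ) * K + K - K * K = K by ring] at hvol
      rcases hvol with ⟨-, v, d, h, h'⟩ | ⟨-, h⟩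
      · refine absurd (hslab v d ?_) (by linarith)
        rw [hLeqK]; exact h
      · exact hdvd h

end Solid

/-! ### The critical volume -/

theorem halfVolume_bounds {K L M : ℕ} (hK : 1000 ≤ K) (hKL : K ≤ L) :
    (M : ℤ) * (K * L) - 2 * (K * L) ≤ 2 * ((K * L * (M / 2) + K * (L / 2 + 2) + 1 : ℕ) : ℤ) ∧
    2 * ((K * L * (M / 2) + K * (L / 2 + 2) + 1 : ℕ) : ℤ) ≤ M * (K * L) + 2 * (K * L) := by
  have hM : M = 2 * (M / 2) + M % 2 := (Nat.div_add_mod M 2).symm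
  have hL : L = 2 * (L / 2) + L % 2 := (Nat.div_add_mod L 2).symm
  have hM2 := Nat.mod_lt M two_pos
  have h1 : K * L * M ≤ K * L * (2 * (M / 2) + 1) := Nat.mul_le_mul_left _ (by omega)
  have h2 : K * L * (2 * (M / 2)) ≤ K * L * M := Nat.mul_le_mul_left _ (by omega)
  have h3 : K * (2 * (L / 2)) ≤ K * L := Nat.mul_le_mul_left _ (by omega)
  have h4 : K * 1000 ≤ K * L := Nat.mul_le_mul_left _ (by omega)
  zify at h1 h2 h3 h4
  have h5 : (0 : ℤ) ≤ K * (L / 2 + 2) := by positivity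
  have h6 : (0 : ℤ) ≤ K * L := by positivity
  push_cast
  constructor <;> linarith

/-- The remainder beyond `h` layers is about half a layer, so `4 |d|` is about `2 K L` at least. -/
theorem halfVolume_not_slab {K L : ℕ} (h : ℕ) (hK : 1000 ≤ K) (hKL : K ≤ L) (v d : ℤ)
    (hd : ((K * L * h + K * (L / 2 + 2) + 1 : ℕ) : ℤ) = K * L * v + d) :
    ((K : ℤ) + 16) ^ 2 < 4 * |d| := by
  have hL := Nat.div_add_mod L 2
  have hL2 := Nat.mod_lt L two_pos
  have h3 : K * (2 * (L / 2)) ≤ K * L := Nat.mul_le_mul_left _ (by omega)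
  have h4 : K * L ≤ K * (2 * (L / 2) + 1) := Nat.mul_le_mul_left _ (by omega)
  have h5 : K * K ≤ K * L := Nat.mul_le_mul_left _ hKL
  have h6 : K * 1000 ≤ K * K := Nat.mul_le_mul_left _ hK
  zify at h3 h4 h5 h6 hK
  push_cast at hd
  have hKL0 : (0 : ℤ) ≤ K * L := by positivity
  rcases le_or_gt v h with hv | hv
  · have h7 : (K : ℤ) * L * v ≤ K * L * h := mul_le_mul_of_nonneg_left hv hKL0
    have := le_abs_self d
    linarith
  · have h7 : (K : ℤ) * L * (h + 1) ≤ K * L * v := mul_le_mul_of_nonneg_left hv hKL0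
    have := neg_abs_le d
    linarith

theorem halfVolume_not_dvd {K L : ℕ} (h : ℕ) (hK : 1000 ≤ K) :
    ¬ (K : ℤ) ∣ ((K * L * h + K * (L / 2 + 2) + 1 : ℕ) : ℤ) := by
  rw [Int.natCast_dvd_natCast, Nat.dvd_add_right
    (dvd_add (mul_assoc K L h ▸ dvd_mul_right _ _) (dvd_mul_right _ _)), Nat.dvd_one]
  omega

/-- This dictates the two extra rows in the volume: modulo `K M` it is `2 K + 1` for even `L` and `K
+ 1` for odd `L`. With no extra row (`L` even) or one (`L` odd) the remainder would be `1`. -/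
theorem halfVolume_not_long_slab {K L M : ℕ} (hK : 1000 ≤ K) (hKL : K ≤ L) (hM : M = L + 1)
    (v d : ℤ) (hd : ((K * L * (M / 2) + K * (L / 2 + 2) + 1 : ℕ) : ℤ) = K * M * v + d) :
    256 < 4 * |d| := by
  have key : ∀ (j r : ℤ), (K : ℤ) ≤ r → 2 * r ≤ K * M →
      ((K * L * (M / 2) + K * (L / 2 + 2) + 1 : ℕ) : ℤ) = K * M * j + r → 256 < 4 * |d| := by
    intro j r hr hr' he
    rw [he] at hd
    have hK' : (1000 : ℤ) ≤ K := by exact_mod_cast hK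
    have h0 : (0 : ℤ) ≤ K * M := by positivity
    rcases le_or_gt v j with hv | hv
    · have h7 : (K : ℤ) * M * v ≤ K * M * j := mul_le_mul_of_nonneg_left hv h0
      have := le_abs_self d
      linarith
    · have h7 : (K : ℤ) * M * (j + 1) ≤ K * M * v := mul_le_mul_of_nonneg_left hv h0
      have := neg_abs_le d
      linarith
  have hbig : K * 1000 ≤ K * M := Nat.mul_le_mul_left _ (by omega)
  zify at hbig hK
  rcases Nat.even_or_odd' L with ⟨j, hj | hj⟩
  · refine key j (2 * K + 1) (by linarith) (by linarith) ?_
    have h1 : M / 2 = j := by omega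
    have h2 : L / 2 = j := by omega
    rw [h1, h2, hM, hj]
    push_cast
    ring
  · refine key (j + 1) (K + 1) (by linarith) (by linarith) ?_
    have h1 : M / 2 = j + 1 := by omega
    have h2 : L / 2 = j := by omega
    rw [h1, h2, hM, hj]
    push_cast
    ring

/-- A sequence of naturals that decreases by at most one in each step attains all intermediate
values. -/
theorem exists_eq_of_le_succ {T n : ℕ} (f : Fin (T + 1) → ℕ) (h0 : n ≤ f 0)
    (hT : f (Fin.last T) ≤ n) (hstep : ∀ t : Fin T, f t.castSucc ≤ f t.succ + 1) :
    ∃ t, f t = n := by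
  by_contra! hne
  have h : ∀ t, n < f t := by
    intro t
    induction t using Fin.induction with
    | zero => exact lt_of_le_of_ne h0 (hne 0).symm
    | succ t ih =>
      have := hstep t
      have := hne t.succ
      omega
  exact absurd (h (Fin.last T)) (not_lt.2 hT)

/-! ### The Hamiltonian as a sum of line energies -/

section Hamiltonian

/-- The number of broken bonds that a non-constant line has at least. -/
def bondsPerLine : BoundaryCondition → ℕ
  | .openBC => 1
  | .periodicBC => 2

/-- The cyclic successor of a coordinate. -/
def nextCoord {n : ℕ} (i : Fin n) : Fin n := ⟨(i.val + 1) % n, Nat.mod_lt _ i.pos⟩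

/-- There is a bond between `i` and its successor. -/
def HasBond (bc : BoundaryCondition) {n : ℕ} (i : Fin n) : Prop :=
  match bc with
  | .openBC => i.val + 1 < n
  | .periodicBC => True

open Classical in
/-- The number of broken bonds on a line. -/
noncomputable def lineEnergy (bc : BoundaryCondition) {n q : ℕ} (f : Fin n → Fin q) : ℕ :=
  (Finset.univ.filter fun i => HasBond bc i ∧ f i ≠ f (nextCoord i)).card

theorem coordDist_eq_zero {bc : BoundaryCondition} {n : ℕ} {i j : Fin n} :
    coordDist bc n i j = 0 ↔ i = j := by
  cases bc with
  | openBC => simp only [coordDist]; omega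
  | periodicBC =>
    have : NeZero n := ⟨i.pos.ne'⟩
    simp only [coordDist, Int.natAbs_eq_zero, ZMod.valMinAbs_eq_zero, sub_eq_zero]
    rw [ZMod.natCast_eq_natCast_iff', Nat.mod_eq_of_lt i.2, Nat.mod_eq_of_lt j.2, Fin.ext_iff]

theorem nextCoord_eq_iff {n : ℕ} [NeZero n] {i j : Fin n} :
    j = nextCoord i ↔ (j.val : ZMod n) = i.val + 1 := by
  rw [← Nat.cast_one, ← Nat.cast_add, ZMod.natCast_eq_natCast_iff', Nat.mod_eq_of_lt j.2,
    Fin.ext_iff]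
  rfl

theorem natAbs_valMinAbs_eq_one {n : ℕ} (hn : 3 ≤ n) (a : ZMod n) :
    a.valMinAbs.natAbs = 1 ↔ a = 1 ∨ a = -1 := by
  have : NeZero n := ⟨by omega⟩
  constructor
  · intro h
    have h1 := ZMod.coe_valMinAbs a
    rcases Int.natAbs_eq_iff.1 h with h2 | h2 <;> rw [h2] at h1
    · left; simpa using h1.symm
    · right; simpa using h1.symm
  · have h1 : (1 : ZMod n).valMinAbs = 1 := by
      rw [ZMod.valMinAbs_spec]
      simp
      omega
    rintro (rfl | rfl)
    · rw [h1]; rfl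
    · rw [ZMod.natAbs_valMinAbs_neg, h1]; rfl

theorem coordDist_eq_one {bc : BoundaryCondition} {n : ℕ} (hn : 3 ≤ n) {i j : Fin n} :
    coordDist bc n i j = 1 ↔
      (HasBond bc i ∧ j = nextCoord i) ∨ (HasBond bc j ∧ i = nextCoord j) := by
  have : NeZero n := ⟨by omega⟩
  cases bc with
  | openBC =>
    have hm : ∀ k : Fin n, k.val + 1 < n → (k.val + 1) % n = k.val + 1 := fun k hk =>
      Nat.mod_eq_of_lt hk
    simp only [coordDist, HasBond, nextCoord, Fin.ext_iff]
    constructor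
    · intro h
      rcases lt_or_ge i.val j.val with hij | hij
      · left; have := j.2; rw [hm i (by omega)]; omega
      · right; have := i.2; rw [hm j (by omega)]; omega
    · rintro (⟨h, h'⟩ | ⟨h, h'⟩) <;> rw [hm _ h] at h' <;> omega
  | periodicBC =>
    simp only [coordDist, HasBond, true_and]
    rw [natAbs_valMinAbs_eq_one hn, nextCoord_eq_iff, nextCoord_eq_iff, or_comm]
    refine or_congr ⟨fun h => ?_, fun h => ?_⟩ ⟨fun h => ?_, fun h => ?_⟩
    · linear_combination -h
    · rw [h]; ring
    · linear_combination h
    · rw [h]; ring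

/-- On a cycle of length two the successor is also the predecessor; `3 ≤ n` keeps the two
orientations of a bond apart in the double count below. -/
theorem nextCoord_asymm {n : ℕ} (hn : 3 ≤ n) {i j : Fin n} (h : j = nextCoord i) :
    i ≠ nextCoord j := by
  intro h'
  rw [Fin.ext_iff] at h h'
  simp only [nextCoord] at h h'
  have hi := i.2
  have hj := j.2
  rcases Nat.lt_or_ge (i.val + 1) n with h1 | h1
  · rw [Nat.mod_eq_of_lt h1] at h
    rcases Nat.lt_or_ge (j.val + 1) n with h2 | h2
    · rw [Nat.mod_eq_of_lt h2] at h'; omega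
    · have : j.val + 1 = n := by omega
      rw [this, Nat.mod_self] at h'; omega
  · have : i.val + 1 = n := by omega
    rw [this, Nat.mod_self] at h
    rw [h, Nat.mod_eq_of_lt (by omega)] at h'
    omega

theorem sum_coordDist_eq_one (bc : BoundaryCondition) {n q : ℕ} (hn : 3 ≤ n) (f : Fin n → Fin q) :
    ∑ i, ∑ j, (if coordDist bc n i j = 1 ∧ f i ≠ f j then 1 else 0) = 2 * lineEnergy bc f := by
  classical
  have h : ∀ i j : Fin n, (if coordDist bc n i j = 1 ∧ f i ≠ f j then 1 else 0) =
      (if j = nextCoord i then (if HasBond bc i ∧ f i ≠ f (nextCoord i) then 1 else 0) else 0) +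
      (if i = nextCoord j then (if HasBond bc j ∧ f j ≠ f (nextCoord j) then 1 else 0) else 0) := by
    intro i j
    simp only [coordDist_eq_one hn]
    by_cases h1 : j = nextCoord i
    · have h2 := nextCoord_asymm hn h1
      rw [if_pos h1, if_neg h2]
      rw [← h1]
      simp [h2]
    · rw [if_neg h1]
      by_cases h2 : i = nextCoord j
      · rw [if_pos h2, ← h2]
        simp [h1, ne_comm]
      · rw [if_neg h2]; simp [h1, h2]
  simp_rw [h, Finset.sum_add_distrib]
  rw [Finset.sum_comm (f := fun i j => if i = nextCoord j then _ else _)]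
  simp only [Finset.sum_ite_eq', Finset.mem_univ, if_true]
  rw [lineEnergy, Finset.card_filter]
  ring

end Hamiltonian

section Hamiltonian

/-- Both sides sum over the darts of the graph, since every edge carries two. -/
theorem two_mul_hamiltonian (bc : BoundaryCondition) {q K L M : ℕ} (σ : Config q K L M) :
    2 * hamiltonian bc σ =
      ((∑ p, ∑ p', if sqDist bc p p' = 1 ∧ σ p ≠ σ p' then 1 else 0 : ℕ) : ℝ) := by
  have h1 : ∑ d : (lattice bc K L M).Dart, disagree σ d.edge = 2 * hamiltonian bc σ := by
    rw [hamiltonian, Finset.mul_sum,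
      ← Finset.sum_fiberwise_of_maps_to (s := Finset.univ) (t := (lattice bc K L M).edgeFinset)
        (g := SimpleGraph.Dart.edge) (fun d _ => SimpleGraph.mem_edgeFinset.2 d.edge_mem)]
    refine Finset.sum_congr rfl fun e he => ?_
    rw [Finset.sum_congr rfl (g := fun _ => disagree σ e)
      (fun d hd => by rw [(Finset.mem_filter.1 hd).2]), Finset.sum_const,
      (lattice bc K L M).dart_edge_fiber_card e (SimpleGraph.mem_edgeFinset.1 he)]
    simp
  rw [← h1, ← Fintype.sum_prod_type' (f := fun p p' =>
    if sqDist bc p p' = 1 ∧ σ p ≠ σ p' then 1 else 0)]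
  push_cast
  have h2 : ∀ x : Site K L M × Site K L M,
      (if sqDist bc x.1 x.2 = 1 ∧ σ x.1 ≠ σ x.2 then (1 : ℝ) else 0) =
      if (lattice bc K L M).Adj x.1 x.2 then disagree σ s(x.1, x.2) else 0 := by
    intro x
    simp only [disagree, Sym2.lift_mk, lattice, ite_and]
    by_cases h : sqDist bc x.1 x.2 = 1 <;> simp [h]
  rw [Finset.sum_congr rfl fun x _ => h2 x, ← Finset.sum_filter]
  refine Finset.sum_bij (fun d _ => d.toProd) (fun d _ => by simp)
    (fun d _ d' _ h => SimpleGraph.Dart.ext _ _ h) (fun x hx =>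
        ⟨⟨x, by simpa using hx⟩, by simp, rfl⟩)
    (fun d _ => rfl)

theorem sqDist_eq_one {bc : BoundaryCondition} {K L M : ℕ} {x x' : Fin K} {y y' : Fin L}
    {z z' : Fin M} {P : Prop} [Decidable P] :
    (if sqDist bc (x, y, z) (x', y', z') = 1 ∧ P then 1 else 0) =
      (if y = y' then if z = z' then if coordDist bc K x x' = 1 ∧ P then 1 else 0 else 0 else 0) +
      (if x = x' then if z = z' then if coordDist bc L y y' = 1 ∧ P then 1 else 0 else 0 else 0) +
      (if x = x' then if y = y' then
        if coordDist bc M z z' = 1 ∧ P then 1 else 0 else 0 else 0) := by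
  have key : ∀ a b c : ℕ, a ^ 2 + b ^ 2 + c ^ 2 = 1 ↔
      (b = 0 ∧ c = 0 ∧ a = 1) ∨ (a = 0 ∧ c = 0 ∧ b = 1) ∨ (a = 0 ∧ b = 0 ∧ c = 1) := by
    intro a b c
    constructor
    · intro h
      have ha : a ≤ 1 := by by_contra! h'; nlinarith
      have hb : b ≤ 1 := by by_contra! h'; nlinarith
      have hc : c ≤ 1 := by by_contra! h'; nlinarith
      interval_cases a <;> interval_cases b <;> interval_cases c <;> simp_all
    · rintro (⟨rfl, rfl, rfl⟩ | ⟨rfl, rfl, rfl⟩ | ⟨rfl, rfl, rfl⟩) <;> rfl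
  simp only [sqDist, key, ← coordDist_eq_zero (bc := bc)]
  by_cases h : P
  · simp only [h, and_true]
    split_ifs <;> first | rfl | omega
  · simp [h]

theorem sum_rotate {α β γ : Type*} [Fintype α] [Fintype β] [Fintype γ] (F : α → β → γ → ℕ) :
    ∑ x, ∑ y, ∑ z, F x y z = ∑ z, ∑ x, ∑ y, F x y z := by
  rw [Finset.sum_congr rfl fun x _ => Finset.sum_comm (f := F x)]
  exact Finset.sum_comm

theorem hamiltonian_eq (bc : BoundaryCondition) {q K L M : ℕ} (hK : 3 ≤ K) (hL : 3 ≤ L)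
    (hM : 3 ≤ M) (σ : Config q K L M) :
    hamiltonian bc σ = ((∑ z, ∑ y, lineEnergy bc (fun x => σ (x, y, z)) +
      ∑ z, ∑ x, lineEnergy bc (fun y => σ (x, y, z)) +
      ∑ x, ∑ y, lineEnergy bc (fun z => σ (x, y, z)) : ℕ) : ℝ) := by
  have h := two_mul_hamiltonian bc σ
  have h2 : (∑ p, ∑ p', if sqDist bc p p' = 1 ∧ σ p ≠ σ p' then 1 else 0) =
      2 * (∑ z, ∑ y, lineEnergy bc (fun x => σ (x, y, z)) +
      ∑ z, ∑ x, lineEnergy bc (fun y => σ (x, y, z)) +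
      ∑ x, ∑ y, lineEnergy bc (fun z => σ (x, y, z))) := by
    simp only [Fintype.sum_prod_type, sqDist_eq_one, Finset.sum_add_distrib, mul_add,
      Finset.mul_sum, ← sum_coordDist_eq_one bc hK, ← sum_coordDist_eq_one bc hL,
      ← sum_coordDist_eq_one bc hM]
    simp only [Finset.sum_ite_irrel, Finset.sum_const_zero, Finset.sum_ite_eq, Finset.mem_univ,
      if_true]
    refine congrArg₂ _ (congrArg₂ _ ?_ ?_) rfl
    · rw [sum_rotate]
      exact Finset.sum_congr rfl fun z _ => Finset.sum_comm
    · rw [sum_rotate]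
  rw [h2] at h
  push_cast at h ⊢
  linarith

end Hamiltonian

/-! ### Broken bonds on a single line -/

section LineEnergy

theorem exists_ne_succ {β : Type*} (g : ℕ → β) {a b : ℕ} (hab : a ≤ b) (h : g a ≠ g b) :
    ∃ k, a ≤ k ∧ k < b ∧ g k ≠ g (k + 1) := by
  by_contra! hc
  have : ∀ k, a ≤ k → k ≤ b → g a = g k := by
    intro k hk
    induction k, hk using Nat.le_induction with
    | base => exact fun _ => rfl
    | succ k hk ih => exact fun hkb => (ih (by omega)).trans (hc k hk (by omega))
  exact h (this b hab le_rfl)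

/-- The spin changes somewhere between `i` and `j`. On a cycle it also changes on the way back from
`j` to `i + n`, which is a different bond. -/
theorem bondsPerLine_le_lineEnergy (bc : BoundaryCondition) {n q : ℕ} (f : Fin n → Fin q)
    {i j : Fin n} (hij : f i ≠ f j) : bondsPerLine bc ≤ lineEnergy bc f := by
  wlog hlt : i.val < j.val generalizing i j
  · refine this hij.symm (lt_of_le_of_ne (not_lt.1 hlt) fun h => hij ?_)
    rw [Fin.ext h]
  set g : ℕ → Fin q := fun k => f ⟨k % n, Nat.mod_lt _ i.pos⟩ with hg
  have hgi : ∀ k : Fin n, g k.val = f k := fun k => by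
    simp only [hg, Nat.mod_eq_of_lt k.2]
  have hnext : ∀ k : ℕ, g k ≠ g (k + 1) →
      f ⟨k % n, Nat.mod_lt _ i.pos⟩ ≠ f (nextCoord ⟨k % n, Nat.mod_lt _ i.pos⟩) := by
    intro k hk
    simpa [hg, nextCoord] using hk
  obtain ⟨k, hik, hkj, hk⟩ := exists_ne_succ g hlt.le (by rwa [hgi, hgi])
  have hj := j.2
  cases bc with
  | openBC =>
    refine Finset.card_pos.2 ⟨⟨k % n, Nat.mod_lt _ i.pos⟩, ?_⟩
    simp only [Finset.mem_filter, Finset.mem_univ, true_and]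
    refine ⟨?_, hnext k hk⟩
    simp only [HasBond]
    rw [Nat.mod_eq_of_lt (by omega)]
    omega
  | periodicBC =>
    have hin : g (i.val + n) = f i := by
      rw [← hgi i]
      simp only [hg, Nat.add_mod_right]
    obtain ⟨l, hjl, hli, hl⟩ := exists_ne_succ g (show j.val ≤ i.val + n by omega)
      (by rw [hgi, hin]; exact hij.symm)
    refine Finset.one_lt_card.2 ⟨⟨k % n, Nat.mod_lt _ i.pos⟩, ?_, ⟨l % n, Nat.mod_lt _ i.pos⟩, ?_,
        ?_⟩
    · simp only [Finset.mem_filter, Finset.mem_univ, true_and]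
      exact ⟨trivial, hnext k hk⟩
    · simp only [Finset.mem_filter, Finset.mem_univ, true_and]
      exact ⟨trivial, hnext l hl⟩
    · rw [Ne, Fin.mk.injEq, Nat.mod_eq_of_lt (show k < n by omega)]
      rcases Nat.lt_or_ge l n with h | h
      · rw [Nat.mod_eq_of_lt h]; omega
      · rw [Nat.mod_eq_sub_mod h, Nat.mod_eq_of_lt (by omega)]; omega

theorem lineEnergy_eq_zero (bc : BoundaryCondition) {n q : ℕ} {f : Fin n → Fin q}
    (h : ∀ i j, f i = f j) : lineEnergy bc f = 0 := by
  classical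
  exact Finset.card_eq_zero.2 (Finset.eq_empty_of_forall_notMem fun i hi =>
    (Finset.mem_filter.1 hi).2.2 (h _ _))

/-- A line with one change of spin has the least possible energy. -/
theorem lineEnergy_threshold_le (bc : BoundaryCondition) {n q : ℕ} {f : Fin n → Fin q}
    {r : Fin n → ℕ} (hr : Monotone r) (m : ℕ) (a b : Fin q)
    (hf : ∀ i, f i = if r i < m then b else a) : lineEnergy bc f ≤ bondsPerLine bc := by
  classical
  set S : Finset (Fin n) := Finset.univ.filter fun i => i.val + 1 < n ∧ f i ≠ f (nextCoord i)
  have hS : S.card ≤ 1 := by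
    rw [Finset.card_le_one]
    have key : ∀ i ∈ S, r i < m ∧ ∀ j : Fin n, i < j → m ≤ r j := by
      intro i hi
      obtain ⟨h1, h2⟩ := (Finset.mem_filter.1 hi).2
      have hnv : (nextCoord i).val = i.val + 1 := Nat.mod_eq_of_lt h1
      have hle : r i ≤ r (nextCoord i) := hr (by rw [Fin.le_def, hnv]; omega)
      rw [hf, hf] at h2
      have h3 : r i < m ∧ m ≤ r (nextCoord i) := by
        by_cases h4 : r (nextCoord i) < m
        · rw [if_pos h4, if_pos (by omega)] at h2
          exact absurd rfl h2
        · by_cases h5 : r i < m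
          · exact ⟨h5, not_lt.1 h4⟩
          · rw [if_neg h4, if_neg h5] at h2
            exact absurd rfl h2
      refine ⟨h3.1, fun j hj => h3.2.trans (hr ?_)⟩
      rw [Fin.le_def, hnv]
      exact hj
    intro i hi j hj
    rcases lt_trichotomy i j with h | h | h
    · have := (key i hi).2 j h
      have := (key j hj).1
      omega
    · exact h
    · have := (key j hj).2 i h
      have := (key i hi).1
      omega
  cases bc with
  | openBC =>
    refine (Finset.card_le_card fun i hi => ?_).trans hS
    rw [Finset.mem_filter]
    exact Finset.mem_filter.1 hi
  | periodicBC =>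
    -- The bond that closes the cycle is the only one not covered by `S`.
    set W : Finset (Fin n) := Finset.univ.filter fun i => i.val + 1 = n
    have hW : W.card ≤ 1 := by
      rw [Finset.card_le_one]
      intro i hi j hj
      have h1 := (Finset.mem_filter.1 hi).2
      have h2 := (Finset.mem_filter.1 hj).2
      exact Fin.ext (by omega)
    calc lineEnergy .periodicBC f ≤ (S ∪ W).card := by
          refine Finset.card_le_card fun i hi => ?_
          have h1 := (Finset.mem_filter.1 hi).2.2
          have h2 := i.2
          rw [Finset.mem_union, Finset.mem_filter, Finset.mem_filter]
          rcases Nat.lt_or_ge (i.val + 1) n with h | h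
          · exact Or.inl ⟨Finset.mem_univ _, h, h1⟩
          · exact Or.inr ⟨Finset.mem_univ _, by omega⟩
      _ ≤ S.card + W.card := Finset.card_union_le _ _
      _ ≤ 2 := by omega

end LineEnergy

/-! ### Lower bound for every path -/

section LowerBound

/-- The region occupied by the spin `a`. -/
def spinRegion {q K L M : ℕ} (σ : Config q K L M) (a : Fin q) : Fin K → Fin L → Fin M → Bool :=
  fun x y z => decide (σ (x, y, z) = a)

theorem mixedInd_mul_le_lineEnergy (bc : BoundaryCondition) {n q : ℕ} (f : Fin n → Fin q)
    (a : Fin q) : bondsPerLine bc * mixedInd (fun i => decide (f i = a)) ≤ lineEnergy bc f := by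
  by_cases h : Mixed fun i => decide (f i = a)
  · rw [mixedInd_eq_one h, mul_one]
    obtain ⟨i, j, hij⟩ := h
    exact bondsPerLine_le_lineEnergy bc f (i := i) (j := j) fun he => hij (by simp [he])
  · rw [mixedInd_eq_zero.2 h]; simp

/-- A line mixed for the region of `a` is non-constant for `σ`; identifying all spins other than `a`
thus reduces the `q` colours to two. -/
theorem mixed_lines_le_hamiltonian (bc : BoundaryCondition) {q K L M : ℕ} (hK : 3 ≤ K)
    (hL : 3 ≤ L) (hM : 3 ≤ M) (σ : Config q K L M) (a : Fin q) :
    ((bondsPerLine bc * (mixedX (spinRegion σ a) + mixedY (spinRegion σ a) +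
      mixedZ (spinRegion σ a)) : ℕ) : ℝ) ≤ hamiltonian bc σ := by
  rw [hamiltonian_eq bc hK hL hM, Nat.cast_le, mul_add, mul_add]
  simp only [mixedX, mixedY, mixedZ, mixedCols, mixedRows, Finset.mul_sum]
  refine add_le_add (add_le_add ?_ ?_) ?_ <;>
  exact Finset.sum_le_sum fun _ _ => Finset.sum_le_sum fun _ _ =>
    mixedInd_mul_le_lineEnergy bc _ a

theorem solidVolume_spinRegion {q K L M : ℕ} (σ : Config q K L M) (a : Fin q) :
    solidVolume (spinRegion σ a) = (Finset.univ.filter fun p => σ p = a).card := by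
  rw [Finset.card_filter, Fintype.sum_prod_type]
  simp only [Fintype.sum_prod_type, solidVolume, area, slice, spinRegion, Bool.toNat,
    Bool.cond_decide]
  exact (sum_rotate _).symm

theorem solidVolume_spinRegion_le_of_neighbor {q K L M : ℕ} {σ ζ : Config q K L M}
    (h : Neighbor σ ζ) (a : Fin q) :
    solidVolume (spinRegion σ a) ≤ solidVolume (spinRegion ζ a) + 1 := by
  obtain ⟨-, x, b, rfl⟩ := h
  rw [solidVolume_spinRegion, solidVolume_spinRegion]
  refine le_trans (Finset.card_le_card (t := insert x (Finset.univ.filter fun p =>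
    Function.update σ x b p = a)) fun p hp => ?_) (Finset.card_insert_le _ _)
  rw [Finset.mem_insert, Finset.mem_filter]
  by_cases hpx : p = x
  · exact Or.inl hpx
  · right
    rw [Function.update_of_ne hpx]
    exact ⟨Finset.mem_univ _, (Finset.mem_filter.1 hp).2⟩

/-- The energy barrier between the ground states. -/
def barrier (bc : BoundaryCondition) (K L : ℕ) : ℕ := bondsPerLine bc * (K * L + K + 1)

theorem barrier_le_pathHeight (bc : BoundaryCondition) {q K L M T : ℕ} (hK : 1000 ≤ K)
    (hKL : K ≤ L) (hLM : L ≤ M) {ω : Fin (T + 1) → Config q K L M} (hω : IsPath ω) {a b : Fin q}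
    (hab : a ≠ b) (h0 : ω 0 = mono q K L M a) (hT : ω (Fin.last T) = mono q K L M b) :
    (barrier bc K L : ℝ) ≤ pathHeight bc ω := by
  set n := K * L * (M / 2) + K * (L / 2 + 2) + 1 with hn
  have hb := halfVolume_bounds (M := M) hK hKL
  have hnle : n ≤ K * L * M := by
    have h1 : 4 * (K * L) ≤ M * (K * L) := Nat.mul_le_mul_right _ (by omega)
    have h2 := hb.2
    rw [← hn] at h2
    norm_cast at h2
    linarith
  obtain ⟨t, ht⟩ := exists_eq_of_le_succ (n := n) (fun t => solidVolume (spinRegion (ω t) a))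
    (by
      simp only [h0, solidVolume_spinRegion, mono, Finset.filter_true, Finset.card_univ,
        Fintype.card_prod, Fintype.card_fin]
      linarith)
    (by simp [hT, solidVolume_spinRegion, mono, hab.symm])
    (fun t => solidVolume_spinRegion_le_of_neighbor (hω t) a)
  have hlines := mixed_lines_lower_bound (spinRegion (ω t) a) (Fintype.card_fin K)
    (Fintype.card_fin L) (Fintype.card_fin M) hK hKL hLM (by rw [ht]; exact hb.1)
    (by rw [ht]; exact hb.2)
    (fun v d h => halfVolume_not_slab (M / 2) hK hKL v d (by rw [← hn, ← ht]; exact h))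
    (by rw [ht]; exact halfVolume_not_dvd _ hK)
    (fun hM v d h => halfVolume_not_long_slab hK hKL hM v d (by rw [← hn, ← ht]; exact h))
  calc (barrier bc K L : ℝ) ≤ _ := Nat.cast_le.2 (Nat.mul_le_mul_left (bondsPerLine bc) hlines)
    _ ≤ hamiltonian bc (ω t) :=
      mixed_lines_le_hamiltonian bc (by omega) (by omega) (by omega) (ω t) a
    _ ≤ pathHeight bc ω := Finset.le_sup' (fun t => hamiltonian bc (ω t)) (Finset.mem_univ t)

end LowerBound

/-! ### Upper bound: lexicographic filling -/

section UpperBound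

/-- The position of a site in the lexicographic order. -/
def siteRank {K L M : ℕ} (p : Site K L M) : ℕ := (p.2.2.val * L + p.2.1.val) * K + p.1.val

theorem siteRank_injective {K L M : ℕ} :
    Function.Injective (siteRank (K := K) (L := L) (M := M)) := by
  rintro ⟨x, y, z⟩ ⟨x', y', z'⟩ h
  simp only [siteRank] at h
  have hx := x.2
  have hx' := x'.2
  have hy := y.2
  have hy' := y'.2
  have h1 : x.val = x'.val := by
    have := congrArg (· % K) h
    simpa [Nat.mul_add_mod_of_lt, Nat.mul_add_mod', Nat.mod_eq_of_lt hx, Nat.mod_eq_of_lt hx']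
      using this
  rw [h1] at h
  have h2 := Nat.eq_of_mul_eq_mul_right (show 0 < K by omega) (Nat.add_right_cancel h)
  have h3 : y.val = y'.val := by
    have := congrArg (· % L) h2
    simpa [Nat.mul_add_mod', Nat.mod_eq_of_lt hy, Nat.mod_eq_of_lt hy'] using this
  rw [h3] at h2
  have h4 := Nat.eq_of_mul_eq_mul_right (show 0 < L by omega) (Nat.add_right_cancel h2)
  simp [Fin.ext_iff, h1, h3, h4]

theorem siteRank_lt {K L M : ℕ} (p : Site K L M) : siteRank p < K * L * M := by
  obtain ⟨x, y, z⟩ := p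
  have h1 : z.val * L + y.val < M * L := by
    have : (z.val + 1) * L ≤ M * L := Nat.mul_le_mul_right _ z.2
    have := y.2
    linarith
  have h2 : (z.val * L + y.val + 1) * K ≤ M * L * K := Nat.mul_le_mul_right _ h1
  have := x.2
  simp only [siteRank]
  linarith

theorem exists_siteRank_eq {K L M m : ℕ} (hm : m < K * L * M) :
    ∃ p : Site K L M, siteRank p = m := by
  have h : Function.Bijective fun p : Site K L M =>
      (⟨siteRank p, siteRank_lt p⟩ : Fin (K * L * M)) := by
    rw [Fintype.bijective_iff_injective_and_card]
    refine ⟨fun p p' h => siteRank_injective (Fin.mk.inj h), ?_⟩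
    simp only [Fintype.card_prod, Fintype.card_fin]
    ring
  obtain ⟨p, hp⟩ := h.2 ⟨m, hm⟩
  exact ⟨p, Fin.mk.inj hp⟩

/-- The first `m` sites have spin `b`, the others spin `a`. -/
def fillConfig (q K L M : ℕ) (a b : Fin q) (m : ℕ) : Config q K L M :=
  fun p => if siteRank p < m then b else a

theorem fillConfig_neighbor {q K L M m : ℕ} {a b : Fin q} (hab : a ≠ b) (hm : m < K * L * M) :
    Neighbor (fillConfig q K L M a b m) (fillConfig q K L M a b (m + 1)) := by
  obtain ⟨p, hp⟩ := exists_siteRank_eq hm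
  refine ⟨fun h => ?_, p, b, ?_⟩
  · have := congrFun h p
    simp only [fillConfig, hp, lt_irrefl, if_false, Nat.lt_succ_self, if_true] at this
    exact hab this.symm
  · funext p'
    by_cases hpp : p' = p
    · rw [hpp, Function.update_self]
      simp [fillConfig, hp]
    · rw [Function.update_of_ne hpp]
      have hne : siteRank p' ≠ m := fun h => hpp (siteRank_injective (h.trans hp.symm))
      have : siteRank p' < m + 1 ↔ siteRank p' < m := by omega
      simp [fillConfig, this]

/-- Sums in which only few terms, each of size at most `c`, do not vanish. -/
theorem sum_sum_le_of_unique {ι κ : Type*} [Fintype ι] [Fintype κ] {F : ι → κ → ℕ} {c N : ℕ}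
    (hκ : Fintype.card κ ≤ N) (hF : ∀ i k, F i k ≤ c)
    (huniq : ∀ i i' k k', F i k ≠ 0 → F i' k' ≠ 0 → i = i') : ∑ i, ∑ k, F i k ≤ c * N := by
  classical
  by_cases h : ∃ i k, F i k ≠ 0
  · obtain ⟨i, k, hik⟩ := h
    rw [Finset.sum_eq_single i (fun i' _ hi' => Finset.sum_eq_zero fun k' _ => by
      by_contra hne
      exact hi' (huniq i' i k' k hne hik)) (by simp)]
    calc ∑ k, F i k ≤ ∑ _k : κ, c := Finset.sum_le_sum fun k _ => hF i k
      _ = c * Fintype.card κ := by simp [mul_comm]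
      _ ≤ c * N := Nat.mul_le_mul_left _ hκ
  · push Not at h
    simp [h]

theorem exists_threshold_of_lineEnergy_ne_zero {bc : BoundaryCondition} {n q : ℕ}
    {f : Fin n → Fin q} {r : Fin n → ℕ} {m : ℕ} {a b : Fin q}
    (hf : ∀ i, f i = if r i < m then b else a) (h : lineEnergy bc f ≠ 0) :
    ∃ i j, r i < m ∧ m ≤ r j := by
  by_contra! hc
  refine h (lineEnergy_eq_zero bc fun i j => ?_)
  rw [hf, hf]
  by_cases hi : r i < m <;> by_cases hj : r j < m
  · rw [if_pos hi, if_pos hj]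
  · exact absurd (hc i j hi) hj
  · exact absurd (hc j i hj) hi
  · rw [if_neg hi, if_neg hj]

theorem hamiltonian_fillConfig_le (bc : BoundaryCondition) {q K L M : ℕ} (hK : 3 ≤ K) (hL : 3 ≤ L)
    (hM : 3 ≤ M) (a b : Fin q) (m : ℕ) :
    hamiltonian bc (fillConfig q K L M a b m) ≤ barrier bc K L := by
  rw [hamiltonian_eq bc hK hL hM, Nat.cast_le]
  set c := bondsPerLine bc with hc
  have hx : ∀ (y : Fin L) (z : Fin M), Monotone fun x : Fin K => siteRank (x, y, z) := by
    intro y z i j hij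
    exact Nat.add_le_add_left hij _
  have hy : ∀ (x : Fin K) (z : Fin M), Monotone fun y : Fin L => siteRank (x, y, z) := by
    intro x z i j hij
    exact Nat.add_le_add_right (Nat.mul_le_mul_right _ (Nat.add_le_add_left hij _)) _
  have hz : ∀ (x : Fin K) (y : Fin L), Monotone fun z : Fin M => siteRank (x, y, z) := by
    intro x y i j hij
    exact Nat.add_le_add_right (Nat.mul_le_mul_right _
      (Nat.add_le_add_right (Nat.mul_le_mul_right _ hij) _)) _
  have h1 : ∑ z, ∑ y, lineEnergy bc (fun x => fillConfig q K L M a b m (x, y, z)) ≤ c * 1 := by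
    rw [← Fintype.sum_prod_type' (f := fun z y =>
      lineEnergy bc (fun x => fillConfig q K L M a b m (x, y, z)))]
    have := sum_sum_le_of_unique (ι := Fin M × Fin L) (κ := Unit) (N := 1) (c := c)
      (F := fun w _ => lineEnergy bc (fun x => fillConfig q K L M a b m (x, w.2, w.1)))
      (by simp) (fun w _ => lineEnergy_threshold_le bc (hx w.2 w.1) m a b fun _ => rfl) ?_
    · simpa using this
    · rintro ⟨z, y⟩ ⟨z', y'⟩ - - h h'
      obtain ⟨i, j, hi, hj⟩ := exists_threshold_of_lineEnergy_ne_zero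
        (r := fun x => siteRank (x, y, z)) (fun _ => rfl) h
      obtain ⟨i', j', hi', hj'⟩ := exists_threshold_of_lineEnergy_ne_zero
        (r := fun x => siteRank (x, y', z')) (fun _ => rfl) h'
      simp only [siteRank] at hi hj hi' hj'
      -- A broken row contains ranks on both sides of `m`, and the ranks of distinct rows form
      -- disjoint intervals.
      have key : ∀ {u v : ℕ} (i j : Fin K), u * K + i.val < m → m ≤ v * K + j.val → u ≤ v := by
        intro u v i j h1 h2
        by_contra! huv
        have h3 : (v + 1) * K ≤ u * K := Nat.mul_le_mul_right _ huv
        have := j.2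
        linarith
      have he : z.val * L + y.val = z'.val * L + y'.val :=
        le_antisymm (key i j' hi hj') (key i' j hi' hj)
      have hys : y.val = y'.val := by
        have := congrArg (· % L) he
        simpa [Nat.mul_add_mod', Nat.mod_eq_of_lt y.2, Nat.mod_eq_of_lt y'.2] using this
      rw [hys] at he
      have hzs := Nat.eq_of_mul_eq_mul_right (show 0 < L by omega) (Nat.add_right_cancel he)
      rw [Fin.ext hys, Fin.ext hzs]
  have h2 : ∑ z, ∑ x, lineEnergy bc (fun y => fillConfig q K L M a b m (x, y, z)) ≤ c * K := by
    refine sum_sum_le_of_unique (by simp) (fun z x =>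
      lineEnergy_threshold_le bc (hy x z) m a b fun _ => rfl) ?_
    intro z z' x x' h h'
    obtain ⟨i, j, hi, hj⟩ := exists_threshold_of_lineEnergy_ne_zero
      (r := fun y => siteRank (x, y, z)) (fun _ => rfl) h
    obtain ⟨i', j', hi', hj'⟩ := exists_threshold_of_lineEnergy_ne_zero
      (r := fun y => siteRank (x', y, z')) (fun _ => rfl) h'
    simp only [siteRank] at hi hj hi' hj'
    -- The same for layers: only the layer being filled has broken lines in the second direction, at
    -- most `K` of them.
    have key : ∀ {u v : ℕ} (i j : Fin L) (x x' : Fin K), (u * L + i.val) * K + x.val < m →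
        m ≤ (v * L + j.val) * K + x'.val → u ≤ v := by
      intro u v i j x x' h1 h2
      by_contra! huv
      have h3 : (v + 1) * (L * K) ≤ u * (L * K) := Nat.mul_le_mul_right _ huv
      have h4 : (j.val + 1) * K ≤ L * K := Nat.mul_le_mul_right _ j.2
      have h5 : 0 ≤ i.val * K := Nat.zero_le _
      have := x'.2
      linarith
    exact Fin.ext (le_antisymm (key i j' x x' hi hj') (key i' j x' x hi' hj))
  have h3 : ∑ x, ∑ y, lineEnergy bc (fun z => fillConfig q K L M a b m (x, y, z)) ≤
      c * (K * L) := by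
    calc _ ≤ ∑ _x : Fin K, ∑ _y : Fin L, c := Finset.sum_le_sum fun x _ =>
          Finset.sum_le_sum fun y _ => lineEnergy_threshold_le bc (hz x y) m a b fun _ => rfl
      _ = c * (K * L) := by
        simp only [Finset.sum_const, Finset.card_univ, Fintype.card_fin, smul_eq_mul]
        ring
  calc _ ≤ c * 1 + c * K + c * (K * L) := add_le_add (add_le_add h1 h2) h3
    _ = barrier bc K L := by rw [barrier]; ring

theorem exists_path_le_barrier (bc : BoundaryCondition) {q K L M : ℕ} (hK : 3 ≤ K) (hL : 3 ≤ L)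
    (hM : 3 ≤ M) {a b : Fin q} (hab : a ≠ b) :
    ∃ h ∈ pathHeights bc (mono q K L M a) (mono q K L M b), h ≤ barrier bc K L := by
  refine ⟨_, ⟨K * L * M, fun t => fillConfig q K L M a b t.val, fun t => ?_,
    Or.inl ⟨?_, ?_⟩, rfl⟩, ?_⟩
  · exact fillConfig_neighbor hab t.2
  · funext p
    simp [fillConfig, mono]
  · funext p
    simp [fillConfig, mono, siteRank_lt p]
  · exact Finset.sup'_le _ _ fun t _ => hamiltonian_fillConfig_le bc hK hL hM a b t.val

end UpperBound

/-! ### The energy barrier -/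

theorem isLeast_pathHeights (bc : BoundaryCondition) {q K L M : ℕ} (hK : 1000 ≤ K)
    (hKL : K ≤ L) (hLM : L ≤ M) {a b : Fin q} (hab : a ≠ b) :
    IsLeast (pathHeights bc (mono q K L M a) (mono q K L M b)) (barrier bc K L) := by
  have hlow : ∀ h ∈ pathHeights bc (mono q K L M a) (mono q K L M b), (barrier bc K L : ℝ) ≤ h := by
    rintro h ⟨T, ω, hω, hc, rfl⟩
    rcases hc with ⟨h0, hT⟩ | ⟨h0, hT⟩
    · exact barrier_le_pathHeight bc hK hKL hLM hω hab h0 hT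
    · exact barrier_le_pathHeight bc hK hKL hLM hω hab.symm h0 hT
  refine ⟨?_, hlow⟩
  obtain ⟨h, hmem, hle⟩ := exists_path_le_barrier bc (K := K) (L := L) (M := M) (by omega)
    (by omega) (by omega) hab
  rwa [← le_antisymm hle (hlow h hmem)]

end Potts3D

theorem theorem2p2 (q K L M : ℕ) (hq : 2 ≤ q) (hK : 2829 ≤ K) (hKL : K ≤ L) (hLM : L ≤ M)
    (s s' : Potts3D.Config q K L M) (hs : s ∈ Potts3D.groundStates q K L M)
    (hs' : s' ∈ Potts3D.groundStates q K L M) (hne : s ≠ s') :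
    -- the minimum that defines the communication height is attained
    (∀ bc : Potts3D.BoundaryCondition,
      IsLeast (Potts3D.pathHeights bc s s') (Potts3D.commHeight bc s s')) ∧
    Potts3D.commHeight .periodicBC s s' = 2 * (K : ℝ) * (L : ℝ) + 2 * (K : ℝ) + 2 ∧
    Potts3D.commHeight .openBC s s' = (K : ℝ) * (L : ℝ) + (K : ℝ) + 1 := by
  obtain ⟨a, rfl⟩ := hs
  obtain ⟨b, rfl⟩ := hs'
  have hab : a ≠ b := fun h => hne (by rw [h])
  have hleast : ∀ bc, IsLeast (Potts3D.pathHeights bc (Potts3D.mono q K L M a)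
      (Potts3D.mono q K L M b)) (Potts3D.barrier bc K L) := fun bc =>
    Potts3D.isLeast_pathHeights bc (by omega) hKL hLM hab
  have hcomm : ∀ bc, Potts3D.commHeight bc (Potts3D.mono q K L M a) (Potts3D.mono q K L M b) =
      Potts3D.barrier bc K L := fun bc => (hleast bc).csInf_eq
  refine ⟨fun bc => by rw [hcomm]; exact hleast bc, ?_, ?_⟩ <;> rw [hcomm] <;>
    simp only [Potts3D.barrier, Potts3D.bondsPerLine] <;> push_cast <;> ring
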